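/- Let $K$ be a field, $(C,\Delta,\varepsilon)$ a $K$-coalgebra, and $\mathcal D$ a small $K$-linear category such that each $Hom_{\mathcal D}(X,Y)$ is equipped with a right $C$-comodule structure $\rho_{XY}(f)=f_0\otimes f_1$. Let $\mathcal E\subseteq\mathcal D$ be the subcategory of $C$-coinvariants: it has the same objects, and $g\in Hom_{\mathcal D}(X,Y)$ lies in $\mathcal E$ iff $\rho_{ZY}(gf)=gf_0\otimes f_1$ for all $Z$ and all $f\in Hom_{\mathcal D}(Z,X)$. Suppose that $\mathcal D$ is a $C$-Galois extension of $\mathcal E$, i.e. for all $X,Y$ the canonical map $$can_{XY}: Hom_{\mathcal D}(-,Y)\otimes_{\mathcal E}Hom_{\mathcal D}(X,-)\to Hom_{\mathcal D}(X,Y)\otimes C,\qquad g\otimes f\mapsto gf_0\otimes f_1$$ is bijective. Let $(\mathcal D,C,\psi)$ be the associated canonical entwining structure, $$\psi_{XY}:C\otimes Hom_{\mathcal D}(X,Y)\to Hom_{\mathcal D}(X,Y)\otimes C,\qquad \psi_{XY}(c\otimes f)=f_\psi\otimes c^\psi:=can_{XY}\big(can_{YY}^{-1}(id_Y\otimes c)\cdot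 f\big),$$ where $(g\otimes g')\cdot f=g\otimes g'f$. Let $\mathscr M(\psi)^C_{\mathcal D}$ be the category of entwined modules: right $\mathcal D$-modules $\mathcal N$ (that is, $K$-linear functors $\mathcal D^{op}\to Vect_K$) with a right $C$-comodule structure on each $\mathcal N(X)$ such that $\rho(\mathcal N(f)(n))=\mathcal N(f_\psi)(n_0)\otimes n_1{}^\psi$ for all $f\in Hom_{\mathcal D}(X,Y)$, $n\in\mathcal N(Y)$; morphisms are the objectwise $C$-colinear morphisms of right $\mathcal D$-modules. Suppose there is a collection $\Phi=\{\Phi_{XY}:C\to Hom_{\mathcal D}(X,Y)\}_{X,Y\in Ob(\mathcal D)}$ of right $C$-colinear maps which is convolution invertible, i.e. there are $K$-linear maps $\Phi'_{XY}:C\to Hom_{\mathcal D}(X,Y)$ with $$\Phi_{XY}(c_1)\circ\Phi'_{YX}(c_2)=\varepsilon(c)\,id_Y=\Phi'_{XY}(c_1)\circ\Phi_{YX}(c_2)\qquad\text{for all } X,Y \text{ and all } c\in C.$$ Then the category $Mod\text{-}\mathcal E$ of right $\mathcal E$-modules ($K$-linear functors $\mathcal E^{op}\to Vect_K$) and the category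 $\mathscr M(\psi)^C_{\mathcal D}$ are equivalent. More precisely, the following functors are mutually quasi-inverse equivalences. The functor $Mod\text{-}\mathcal E\to\mathscr M(\psi)^C_{\mathcal D}$ is $\mathcal M\mapsto\mathcal M\otimes_{\mathcal E}h$, where $(\mathcal M\otimes_{\mathcal E}h)(X)=\mathcal M\otimes_{\mathcal E}Hom_{\mathcal D}(X,-)$, with action $(m\otimes g)\cdot f=m\otimes gf$ and coaction $m\otimes g\mapsto m\otimes g_0\otimes g_1$. The functor $\mathscr M(\psi)^C_{\mathcal D}\to Mod\text{-}\mathcal E$ is $\mathcal N\mapsto\mathcal N^{co}$, where, writing $\rho_{XX}(id_X)=id_{X,0}\otimes id_{X,1}$, $$\mathcal N^{co}(X)=\{n\in\mathcal N(X)\mid \rho(n)=\mathcal N(id_{X,0})(n)\otimes id_{X,1}\}.$$ -/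

import Mathlib

open CategoryTheory Opposite
open scoped TensorProduct DirectSum

universe u w₁ w₂

namespace CatGalois

noncomputable section

section Tensor

variable {K : Type w₁} [Field K] {C : Type w₂} [AddCommGroup C] [Module K C]

lemma rTensor_lTensor_apply {M N P Q : Type*} [AddCommGroup M] [Module K M] [AddCommGroup N]
    [Module K N] [AddCommGroup P] [Module K P] [AddCommGroup Q] [Module K Q]
    (f : M →ₗ[K] N) (g : P →ₗ[K] Q) (x : M ⊗[K] P) :
    f.rTensor Q (g.lTensor M x) = g.lTensor N (f.rTensor P x) := by
  rw [← LinearMap.comp_apply, ← LinearMap.comp_apply, LinearMap.rTensor_comp_lTensor,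
    LinearMap.lTensor_comp_rTensor]

lemma assoc_rTensor_rTensor {M N : Type*} [AddCommGroup M] [Module K M] [AddCommGroup N]
    [Module K N] (f : M →ₗ[K] N) (x : (M ⊗[K] C) ⊗[K] C) :
    TensorProduct.assoc K N C C ((f.rTensor C).rTensor C x) =
      f.rTensor (C ⊗[K] C) (TensorProduct.assoc K M C C x) := by
  have : (TensorProduct.assoc K N C C).toLinearMap ∘ₗ (f.rTensor C).rTensor C =
      f.rTensor (C ⊗[K] C) ∘ₗ (TensorProduct.assoc K M C C).toLinearMap := by
    apply TensorProduct.ext_threefold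
    intro a b c
    simp
  exact LinearMap.congr_fun this x

lemma rid_lTensor_rTensor {M N : Type*} [AddCommGroup M] [Module K M] [AddCommGroup N]
    [Module K N] (f : M →ₗ[K] N) (ε : C →ₗ[K] K) (x : M ⊗[K] C) :
    TensorProduct.rid K N (ε.lTensor N (f.rTensor C x)) =
      f (TensorProduct.rid K M (ε.lTensor M x)) := by
  induction x using TensorProduct.induction_on with
  | zero => simp
  | add x y hx hy => simp only [map_add, hx, hy]
  | tmul a c => simp

end Tensor

/-! ### Comodules over a coalgebra -/

section Comodules

variable (K : Type w₁) [Field K] (C : Type w₂) [AddCommGroup C] [Module K C] [Coalgebra K C]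

/-- A right `C`-comodule structure `ρ : M → M ⊗ C` on a `K`-vector space `M`. -/
structure RightCoaction (M : Type*) [AddCommGroup M] [Module K M] where
  /-- the coaction `m ↦ m₀ ⊗ m₁` -/
  coact : M →ₗ[K] M ⊗[K] C
  coassoc : (TensorProduct.assoc K M C C).toLinearMap ∘ₗ coact.rTensor C ∘ₗ coact =
    (Coalgebra.comul (R := K) (A := C)).lTensor M ∘ₗ coact
  counit : (TensorProduct.rid K M).toLinearMap ∘ₗ
    (Coalgebra.counit (R := K) (A := C)).lTensor M ∘ₗ coact = LinearMap.id

variable {K C}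

/-- `f : M → N` is right `C`-colinear: `ρ_N (f m) = f m₀ ⊗ m₁`. -/
def IsColinear {M N : Type*} [AddCommGroup M] [Module K M] [AddCommGroup N] [Module K N]
    (ρM : RightCoaction K C M) (ρN : RightCoaction K C N) (f : M →ₗ[K] N) : Prop :=
  ∀ m, ρN.coact (f m) = f.rTensor C (ρM.coact m)

variable (K C) in
/-- `C` as a right comodule over itself, via the comultiplication. -/
def regularCoaction : RightCoaction K C C where
  coact := Coalgebra.comul
  coassoc := Coalgebra.coassoc
  counit := by
    rw [Coalgebra.lTensor_counit_comp_comul]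
    ext c
    simp

lemma RightCoaction.coassoc_apply {M : Type*} [AddCommGroup M] [Module K M]
    (ρ : RightCoaction K C M) (m : M) :
    TensorProduct.assoc K M C C (ρ.coact.rTensor C (ρ.coact m)) =
      (Coalgebra.comul (R := K) (A := C)).lTensor M (ρ.coact m) :=
  LinearMap.congr_fun ρ.coassoc m

lemma RightCoaction.counit_apply {M : Type*} [AddCommGroup M] [Module K M]
    (ρ : RightCoaction K C M) (m : M) :
    TensorProduct.rid K M ((Coalgebra.counit (R := K) (A := C)).lTensor M (ρ.coact m)) = m :=
  LinearMap.congr_fun ρ.counit m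

end Comodules

/-! ### Right modules over a `K`-linear category -/

section Modules

variable (K : Type w₁) [Field K]

/-- A functor `Dᵒᵖ ⥤ Vect_K` is `K`-linear if it is `K`-linear on spaces of morphisms. -/
def isLinearModule (D : Type u) [Category.{u} D] [Preadditive D] [Linear K D] :
    ObjectProperty (Dᵒᵖ ⥤ ModuleCat.{u} K) := fun F =>
  (∀ {X Y : D} (f g : X ⟶ Y), F.map (f + g).op = F.map f.op + F.map g.op) ∧
  (∀ {X Y : D} (r : K) (f : X ⟶ Y), F.map (r • f).op = r • F.map f.op)

/-- The category `Mod-D` of right `D`-modules: `K`-linear functors `Dᵒᵖ ⥤ Vect_K` and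
natural transformations. -/
abbrev RightMod (D : Type u) [Category.{u} D] [Preadditive D] [Linear K D] :=
  (isLinearModule K D).FullSubcategory

variable {K} {D : Type u} [Category.{u} D] [Preadditive D] [Linear K D]

/-- The action of a right module as a bilinear map `M(Y) → Hom(X,Y) → M(X)`,
`m ↦ f ↦ M(f)(m)`. -/
def RightMod.action (M : RightMod K D) (X Y : D) :
    (M.obj.obj (op Y) : Type u) →ₗ[K] (X ⟶ Y) →ₗ[K] (M.obj.obj (op X) : Type u) :=
  LinearMap.mk₂ K (fun m f => M.obj.map f.op m)
    (fun _ _ _ => map_add _ _ _) (fun _ _ _ => map_smul _ _ _)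
    (fun m f g => by rw [M.property.1]; rfl)
    (fun r m f => by rw [M.property.2]; rfl)

@[simp]
lemma RightMod.action_apply (M : RightMod K D) {X Y : D} (m : M.obj.obj (op Y)) (f : X ⟶ Y) :
    M.action X Y m f = M.obj.map f.op m := rfl

variable (K) in
/-- Composition as a bilinear map `Hom(Y,Z) → Hom(X,Y) → Hom(X,Z)`, `g ↦ f ↦ gf`. -/
def compMap (X Y Z : D) : (Y ⟶ Z) →ₗ[K] (X ⟶ Y) →ₗ[K] (X ⟶ Z) :=
  (Linear.comp (S := K) X Y Z).flip

@[simp]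
lemma compMap_apply {X Y Z : D} (g : Y ⟶ Z) (f : X ⟶ Y) : compMap K X Y Z g f = f ≫ g := rfl

end Modules

/-! ### The tensor product over a category -/

section TensorOver

variable {K : Type w₁} [Field K] {E : Type u} [Category.{u} E]

open scoped Classical in
/-- The relations `m·e ⊗ n = m ⊗ e·n` defining the tensor product over the category `E`. -/
def tensorRel (M : Eᵒᵖ ⥤ ModuleCat.{u} K) (N : E ⥤ ModuleCat.{u} K) :
    Submodule K (⨁ Z : E, (M.obj (op Z) : Type u) ⊗[K] (N.obj Z : Type u)) :=
  Submodule.span K {x | ∃ (Z W : E) (e : Z ⟶ W) (m : M.obj (op W)) (n : N.obj Z),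
    x = DirectSum.lof K E (fun Z : E => (M.obj (op Z) : Type u) ⊗[K] (N.obj Z : Type u)) Z
          (M.map e.op m ⊗ₜ n) -
        DirectSum.lof K E (fun Z : E => (M.obj (op Z) : Type u) ⊗[K] (N.obj Z : Type u)) W
          (m ⊗ₜ N.map e n)}

/-- The tensor product `M ⊗_E N` of a right `E`-module `M` and a left `E`-module `N`:
the quotient of `⨁_Z M(Z) ⊗ N(Z)` by the relations `M(e)(m) ⊗ n = m ⊗ N(e)(n)`. -/
abbrev TensorOver (M : Eᵒᵖ ⥤ ModuleCat.{u} K) (N : E ⥤ ModuleCat.{u} K) : Type u :=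
  (⨁ Z : E, (M.obj (op Z) : Type u) ⊗[K] (N.obj Z : Type u)) ⧸ tensorRel M N

namespace TensorOver

variable (M : Eᵒᵖ ⥤ ModuleCat.{u} K) (N : E ⥤ ModuleCat.{u} K)

open scoped Classical in
/-- The class of `m ⊗ n` in `M ⊗_E N`, for `m ∈ M(Z)` and `n ∈ N(Z)`. -/
def mk (Z : E) : (M.obj (op Z) : Type u) →ₗ[K] (N.obj Z : Type u) →ₗ[K] TensorOver M N :=
  (TensorProduct.mk K _ _).compr₂
    ((tensorRel M N).mkQ ∘ₗ
      DirectSum.lof K E (fun Z : E => (M.obj (op Z) : Type u) ⊗[K] (N.obj Z : Type u)) Z)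

lemma balanced {Z W : E} (e : Z ⟶ W) (m : M.obj (op W)) (n : N.obj Z) :
    mk M N Z (M.map e.op m) n = mk M N W m (N.map e n) := by
  classical
  refine (Submodule.Quotient.eq (tensorRel M N)).2 (Submodule.subset_span ⟨Z, W, e, m, n, ?_⟩)
  congr!

variable {M N}

open scoped Classical in
/-- The linear map out of `M ⊗_E N` determined by a balanced family of bilinear maps. -/
def lift {P : Type*} [AddCommGroup P] [Module K P]
    (φ : ∀ Z : E, (M.obj (op Z) : Type u) →ₗ[K] (N.obj Z : Type u) →ₗ[K] P)
    (hφ : ∀ {Z W : E} (e : Z ⟶ W) (m : M.obj (op W)) (n : N.obj Z),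
      φ Z (M.map e.op m) n = φ W m (N.map e n)) :
    TensorOver M N →ₗ[K] P :=
  (tensorRel M N).liftQ (DirectSum.toModule K E P fun Z => TensorProduct.lift (φ Z)) (by
    rw [tensorRel, Submodule.span_le]
    rintro _ ⟨Z, W, e, m, n, rfl⟩
    simp [hφ])

@[simp]
lemma lift_mk {P : Type*} [AddCommGroup P] [Module K P]
    (φ : ∀ Z : E, (M.obj (op Z) : Type u) →ₗ[K] (N.obj Z : Type u) →ₗ[K] P)
    (hφ : ∀ {Z W : E} (e : Z ⟶ W) (m : M.obj (op W)) (n : N.obj Z),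
      φ Z (M.map e.op m) n = φ W m (N.map e n)) (Z : E) (m : M.obj (op Z)) (n : N.obj Z) :
    lift φ hφ (mk M N Z m n) = φ Z m n := by
  classical
  simp only [lift, mk, LinearMap.compr₂_apply, TensorProduct.mk_apply, LinearMap.comp_apply,
    Submodule.mkQ_apply, Submodule.liftQ_apply]
  rw [DirectSum.toModule_lof]
  simp

lemma hom_ext {P : Type*} [AddCommGroup P] [Module K P] {f g : TensorOver M N →ₗ[K] P}
    (h : ∀ (Z : E) (m : M.obj (op Z)) (n : N.obj Z), f (mk M N Z m n) = g (mk M N Z m n)) :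
    f = g := by
  classical
  apply Submodule.linearMap_qext
  apply DirectSum.linearMap_ext
  intro Z
  apply TensorProduct.ext'
  intro m n
  convert h Z m n using 1 <;> simp [mk]

lemma map_balanced {M' : Eᵒᵖ ⥤ ModuleCat.{u} K} {N' : E ⥤ ModuleCat.{u} K}
    (α : M ⟶ M') (β : N ⟶ N') {Z W : E} (e : Z ⟶ W) (m : M.obj (op W)) (n : N.obj Z) :
    (mk M' N' Z).compl₁₂ (α.app (op Z)).hom (β.app Z).hom (M.map e.op m) n =
      (mk M' N' W).compl₁₂ (α.app (op W)).hom (β.app W).hom m (N.map e n) := by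
  have h1 := ConcreteCategory.congr_hom (α.naturality e.op) m
  have h2 := ConcreteCategory.congr_hom (β.naturality e) n
  have h3 := balanced M' N' e (α.app (op W) m) (β.app Z n)
  simp only [ConcreteCategory.comp_apply] at h1 h2
  rw [← h1, ← h2] at h3
  exact h3

/-- Functoriality of `M ⊗_E N` in both variables. -/
def map {M' : Eᵒᵖ ⥤ ModuleCat.{u} K} {N' : E ⥤ ModuleCat.{u} K} (α : M ⟶ M') (β : N ⟶ N') :
    TensorOver M N →ₗ[K] TensorOver M' N' :=
  lift (fun Z => (mk M' N' Z).compl₁₂ (α.app (op Z)).hom (β.app Z).hom) (map_balanced α β)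

@[simp]
lemma map_mk {M' : Eᵒᵖ ⥤ ModuleCat.{u} K} {N' : E ⥤ ModuleCat.{u} K} (α : M ⟶ M') (β : N ⟶ N')
    (Z : E) (m : M.obj (op Z)) (n : N.obj Z) :
    map α β (mk M N Z m n) = mk M' N' Z (α.app (op Z) m) (β.app Z n) := by
  exact lift_mk _ (map_balanced α β) Z m n

end TensorOver

end TensorOver

/-! ### Entwining structures and entwined modules -/

section Entwining

variable {K : Type w₁} [Field K] {C : Type w₂} [AddCommGroup C] [Module K C]
variable {D : Type u} [Category.{u} D] [Preadditive D] [Linear K D]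

/-- Given `ψ : C ⊗ Hom(X,Y) → Hom(X,Y) ⊗ C`, written `c ⊗ f ↦ f_ψ ⊗ c^ψ`, a bilinear action
`b : N → Hom(X,Y) → P` and `f : X ⟶ Y`, this is the map
`N ⊗ C → P ⊗ C`, `n ⊗ c ↦ n·f_ψ ⊗ c^ψ`. -/
def twist {X Y : D} (ψ : C ⊗[K] (X ⟶ Y) →ₗ[K] (X ⟶ Y) ⊗[K] C)
    {N P : Type*} [AddCommGroup N] [Module K N] [AddCommGroup P] [Module K P]
    (b : N →ₗ[K] (X ⟶ Y) →ₗ[K] P) (f : X ⟶ Y) : N ⊗[K] C →ₗ[K] P ⊗[K] C :=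
  TensorProduct.lift (LinearMap.lcomp K (P ⊗[K] C) (ψ ∘ₗ (TensorProduct.mk K C (X ⟶ Y)).flip f) ∘ₗ
    LinearMap.rTensorHom C ∘ₗ b)

@[simp]
lemma twist_tmul {X Y : D} (ψ : C ⊗[K] (X ⟶ Y) →ₗ[K] (X ⟶ Y) ⊗[K] C)
    {N P : Type*} [AddCommGroup N] [Module K N] [AddCommGroup P] [Module K P]
    (b : N →ₗ[K] (X ⟶ Y) →ₗ[K] P) (f : X ⟶ Y) (n : N) (c : C) :
    twist ψ b f (n ⊗ₜ c) = (b n).rTensor C (ψ (c ⊗ₜ f)) := rfl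

lemma twist_natural {X Y : D} (ψ : C ⊗[K] (X ⟶ Y) →ₗ[K] (X ⟶ Y) ⊗[K] C)
    {N P N' P' : Type*} [AddCommGroup N] [Module K N] [AddCommGroup P] [Module K P]
    [AddCommGroup N'] [Module K N'] [AddCommGroup P'] [Module K P']
    (b : N →ₗ[K] (X ⟶ Y) →ₗ[K] P) (b' : N' →ₗ[K] (X ⟶ Y) →ₗ[K] P')
    (k : N →ₗ[K] N') (l : P →ₗ[K] P') (h : ∀ n g, l (b n g) = b' (k n) g) (f : X ⟶ Y)
    (x : N ⊗[K] C) : l.rTensor C (twist ψ b f x) = twist ψ b' f (k.rTensor C x) := by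
  induction x using TensorProduct.induction_on with
  | zero => simp
  | add x y hx hy => simp only [map_add, hx, hy]
  | tmul n c =>
    rw [LinearMap.rTensor_tmul, twist_tmul, twist_tmul, ← LinearMap.comp_apply,
      ← LinearMap.rTensor_comp]
    congr 2
    ext g
    exact h n g

variable (K C D) [Coalgebra K C]

/-- A (right-right) entwining structure `(D, C, ψ)`; notation `ψ(c ⊗ f) = f_ψ ⊗ c^ψ`. -/
structure EntwiningStructure where
  /-- the maps `ψ_{XY} : C ⊗ Hom(X,Y) → Hom(X,Y) ⊗ C` -/
  psi : ∀ X Y : D, C ⊗[K] (X ⟶ Y) →ₗ[K] (X ⟶ Y) ⊗[K] C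
  /-- `(gf)_ψ ⊗ c^ψ = g_ψ f_ψ ⊗ c^ψ^ψ` -/
  psi_comp : ∀ {X Y Z : D} (f : X ⟶ Y) (g : Y ⟶ Z) (c : C),
    psi X Z (c ⊗ₜ (f ≫ g)) = twist (psi X Y) (compMap K X Y Z) f (psi Y Z (c ⊗ₜ g))
  /-- `ε(c^ψ) f_ψ = ε(c) f` -/
  psi_counit : ∀ {X Y : D} (f : X ⟶ Y) (c : C),
    TensorProduct.rid K (X ⟶ Y)
      ((Coalgebra.counit (R := K) (A := C)).lTensor (X ⟶ Y) (psi X Y (c ⊗ₜ f))) =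
      Coalgebra.counit (R := K) c • f
  /-- `f_ψ ⊗ Δ(c^ψ) = f_ψ_ψ ⊗ c₁^ψ ⊗ c₂^ψ`, where `ψ` is first applied to `c₂ ⊗ f` -/
  psi_comul : ∀ {X Y : D} (f : X ⟶ Y) (c : C),
    (Coalgebra.comul (R := K) (A := C)).lTensor (X ⟶ Y) (psi X Y (c ⊗ₜ f)) =
      TensorProduct.assoc K (X ⟶ Y) C C ((psi X Y).rTensor C
        ((TensorProduct.assoc K C (X ⟶ Y) C).symm ((psi X Y).lTensor C
          (TensorProduct.assoc K C C (X ⟶ Y) (Coalgebra.comul (R := K) c ⊗ₜ f)))))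
  /-- `ψ(c ⊗ id) = id ⊗ c` -/
  psi_id : ∀ (X : D) (c : C), psi X X (c ⊗ₜ 𝟙 X) = 𝟙 X ⊗ₜ c

variable {K C D}

/-- An entwined module over `(D, C, ψ)`: a right `D`-module `M` with a right `C`-comodule
structure on each `M(X)` such that `ρ(M(f)(m)) = M(f_ψ)(m₀) ⊗ m₁^ψ`. -/
structure EntwinedModule (S : EntwiningStructure K C D) where
  /-- the underlying right `D`-module -/
  toMod : RightMod K D
  /-- the coactions -/
  coaction : ∀ X : D, RightCoaction K C (toMod.obj.obj (op X) : Type u)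
  compat : ∀ {X Y : D} (f : X ⟶ Y) (m : toMod.obj.obj (op Y)),
    (coaction X).coact (toMod.obj.map f.op m) =
      twist (S.psi X Y) (toMod.action X Y) f ((coaction Y).coact m)

namespace EntwinedModule

variable {S : EntwiningStructure K C D}

/-- A morphism of entwined modules: a morphism of right `D`-modules which is objectwise
`C`-colinear. -/
@[ext]
structure Hom (M N : EntwinedModule S) where
  /-- the underlying morphism of right `D`-modules -/
  hom : M.toMod ⟶ N.toMod
  colinear : ∀ X : D, IsColinear (M.coaction X) (N.coaction X) (hom.hom.app (op X)).hom

/-- The category of entwined modules. -/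
instance : Category (EntwinedModule S) where
  Hom := Hom
  id M := ⟨𝟙 M.toMod, fun X m => by simp⟩
  comp {M N P} f g := ⟨f.hom ≫ g.hom, fun X m => by
    have h1 := f.colinear X m
    have h2 := g.colinear X ((f.hom.hom.app (op X)).hom m)
    rw [h1] at h2
    simp only [ObjectProperty.FullSubcategory.comp_hom, NatTrans.comp_app, ModuleCat.hom_comp,
      LinearMap.rTensor_comp, LinearMap.comp_apply]
    exact h2⟩
  id_comp f := Hom.ext (Category.id_comp f.hom)
  comp_id f := Hom.ext (Category.comp_id f.hom)
  assoc f g h := Hom.ext (Category.assoc f.hom g.hom h.hom)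

end EntwinedModule

end Entwining

/-! ### Coinvariants and Galois extensions -/

section Galois

variable {K : Type w₁} [Field K] {C : Type w₂} [AddCommGroup C] [Module K C] [Coalgebra K C]
variable {D : Type u} [Category.{u} D] [Preadditive D] [Linear K D]

/-- The morphisms `g : X ⟶ Y` of `D` such that `g ∘ - : Hom(-,X) → Hom(-,Y)` is objectwise
`C`-colinear, i.e. `ρ(gf) = g f₀ ⊗ f₁` for all `f : Z ⟶ X`. -/
def coinvHom (ρ : ∀ X Y : D, RightCoaction K C (X ⟶ Y)) (X Y : D) : Submodule K (X ⟶ Y) where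
  carrier := {g | ∀ Z : D, IsColinear (ρ Z X) (ρ Z Y) (Linear.rightComp K Z g)}
  zero_mem' := by
    intro Z f
    have : Linear.rightComp K Z (0 : X ⟶ Y) = 0 := by ext; simp
    rw [this]; simp
  add_mem' := by
    intro a b ha hb Z f
    have : Linear.rightComp K Z (a + b) = Linear.rightComp K Z a + Linear.rightComp K Z b := by
      ext; simp
    rw [this, LinearMap.rTensor_add, LinearMap.add_apply, LinearMap.add_apply, map_add,
      ha Z f, hb Z f]
  smul_mem' := by
    intro r a ha Z f
    have : Linear.rightComp K Z (r • a) = r • Linear.rightComp K Z a := by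
      ext; simp
    rw [this, LinearMap.rTensor_smul, LinearMap.smul_apply, LinearMap.smul_apply, map_smul,
      ha Z f]

/-- The category `E` of `C`-coinvariants of `D`: the same objects as `D`, and the morphisms in
`coinvHom`. -/
structure CoinvCat (ρ : ∀ X Y : D, RightCoaction K C (X ⟶ Y)) where
  /-- the object of `D` -/
  of : D

variable (ρ : ∀ X Y : D, RightCoaction K C (X ⟶ Y))

instance : Category.{u} (CoinvCat ρ) where
  Hom X Y := coinvHom ρ X.of Y.of
  id X := ⟨𝟙 X.of, fun Z f => by
    have : Linear.rightComp K Z (𝟙 X.of) = LinearMap.id := by ext; simp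
    rw [this]; simp⟩
  comp {X Y Z} f g := ⟨f.1 ≫ g.1, fun W a => by
    have : Linear.rightComp K W (f.1 ≫ g.1) =
        Linear.rightComp K W g.1 ∘ₗ Linear.rightComp K W f.1 := by ext; simp
    rw [this, LinearMap.rTensor_comp, LinearMap.comp_apply, LinearMap.comp_apply,
      g.2 W, f.2 W]⟩
  id_comp f := Subtype.ext (Category.id_comp f.1)
  comp_id f := Subtype.ext (Category.comp_id f.1)
  assoc f g h := Subtype.ext (Category.assoc f.1 g.1 h.1)

instance : Preadditive (CoinvCat ρ) where
  homGroup X Y := inferInstanceAs (AddCommGroup (coinvHom ρ X.of Y.of))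
  add_comp _ _ _ f f' g := Subtype.ext (Preadditive.add_comp _ _ _ f.1 f'.1 g.1)
  comp_add _ _ _ f g g' := Subtype.ext (Preadditive.comp_add _ _ _ f.1 g.1 g'.1)

instance : Linear K (CoinvCat ρ) where
  homModule X Y := inferInstanceAs (Module K (coinvHom ρ X.of Y.of))
  smul_comp _ _ _ r f g := Subtype.ext (Linear.smul_comp _ _ _ r f.1 g.1)
  comp_smul _ _ _ f r g := Subtype.ext (Linear.comp_smul _ _ _ f.1 r g.1)

/-- The inclusion `E ⥤ D`. -/
def coinvIncl : CoinvCat ρ ⥤ D where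
  obj X := X.of
  map f := f.1

/-- `Hom_D(-,Y)` as a right `E`-module. -/
def rep (Y : D) : (CoinvCat ρ)ᵒᵖ ⥤ ModuleCat.{u} K :=
  (coinvIncl ρ).op ⋙ (linearYoneda K D).obj Y

/-- `Hom_D(X,-)` as a left `E`-module. -/
def corep (X : D) : CoinvCat ρ ⥤ ModuleCat.{u} K :=
  coinvIncl ρ ⋙ (linearCoyoneda K D).obj (op X)

/-- For `f : X ⟶ Y`, precomposition `- ∘ f : Hom_D(Y,-) → Hom_D(X,-)`. -/
def corepMap {X Y : D} (f : X ⟶ Y) : corep ρ Y ⟶ corep ρ X :=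
  Functor.whiskerLeft (coinvIncl ρ) ((linearCoyoneda K D).map f.op)

/-- For `g : Y ⟶ Z`, postcomposition `g ∘ - : Hom_D(-,Y) → Hom_D(-,Z)`. -/
def repMap {Y Z : D} (g : Y ⟶ Z) : rep ρ Y ⟶ rep ρ Z :=
  Functor.whiskerLeft (coinvIncl ρ).op ((linearYoneda K D).map g)

section TensorH

variable (M : (CoinvCat ρ)ᵒᵖ ⥤ ModuleCat.{u} K)

/-- `(M ⊗_E h)(X) = M ⊗_E Hom_D(X,-)`. -/
abbrev TensorH (X : D) : Type u := TensorOver M (corep ρ X)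

/-- The element `m ⊗ g` of `M ⊗_E Hom_D(X,-)`, for `m ∈ M(Z)` and `g : X ⟶ Z`. -/
def mkH (X : D) (Z : CoinvCat ρ) :
    (M.obj (op Z) : Type u) →ₗ[K] (X ⟶ Z.of) →ₗ[K] TensorH ρ M X :=
  TensorOver.mk M (corep ρ X) Z

lemma mkH_balanced (X : D) {Z W : CoinvCat ρ} (e : Z ⟶ W) (m : M.obj (op W)) (g : X ⟶ Z.of) :
    mkH ρ M X Z (M.map e.op m) g = mkH ρ M X W m (g ≫ e.1) :=
  TensorOver.balanced M (corep ρ X) e m g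

variable {M} in
lemma TensorH.hom_ext {X : D} {P : Type*} [AddCommGroup P] [Module K P]
    {f g : TensorH ρ M X →ₗ[K] P}
    (h : ∀ (Z : CoinvCat ρ) (m : M.obj (op Z)) (n : X ⟶ Z.of),
      f (mkH ρ M X Z m n) = g (mkH ρ M X Z m n)) : f = g :=
  TensorOver.hom_ext h

variable {M} in
/-- The linear map out of `M ⊗_E Hom_D(X,-)` determined by a balanced family. -/
def TensorH.lift {X : D} {P : Type*} [AddCommGroup P] [Module K P]
    (φ : ∀ Z : CoinvCat ρ, (M.obj (op Z) : Type u) →ₗ[K] (X ⟶ Z.of) →ₗ[K] P)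
    (hφ : ∀ {Z W : CoinvCat ρ} (e : Z ⟶ W) (m : M.obj (op W)) (n : X ⟶ Z.of),
      φ Z (M.map e.op m) n = φ W m (n ≫ e.1)) : TensorH ρ M X →ₗ[K] P :=
  TensorOver.lift φ hφ

variable {M} in
lemma TensorH.lift_mkH {X : D} {P : Type*} [AddCommGroup P] [Module K P]
    (φ : ∀ Z : CoinvCat ρ, (M.obj (op Z) : Type u) →ₗ[K] (X ⟶ Z.of) →ₗ[K] P)
    (hφ : ∀ {Z W : CoinvCat ρ} (e : Z ⟶ W) (m : M.obj (op W)) (n : X ⟶ Z.of),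
      φ Z (M.map e.op m) n = φ W m (n ≫ e.1))
    (Z : CoinvCat ρ) (m : M.obj (op Z)) (n : X ⟶ Z.of) :
    TensorH.lift ρ φ hφ (mkH ρ M X Z m n) = φ Z m n :=
  TensorOver.lift_mk (M := M) (N := corep ρ X) φ hφ Z m n

lemma map_corepMap_mkH {X Y : D} (Z : CoinvCat ρ) (m : M.obj (op Z)) (g : Y ⟶ Z.of) (f : X ⟶ Y) :
    TensorOver.map (𝟙 M) (corepMap ρ f) (mkH ρ M Y Z m g) = mkH ρ M X Z m (f ≫ g) :=
  TensorOver.map_mk (𝟙 M) (corepMap ρ f) Z m g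

variable {M} in
/-- The map `α ⊗ id : M ⊗_E Hom_D(X,-) → M' ⊗_E Hom_D(X,-)`. -/
def mapH {M' : (CoinvCat ρ)ᵒᵖ ⥤ ModuleCat.{u} K} (α : M ⟶ M') (X : D) :
    TensorH ρ M X →ₗ[K] TensorH ρ M' X :=
  TensorOver.map α (𝟙 (corep ρ X))

variable {M} in
lemma mapH_mkH {M' : (CoinvCat ρ)ᵒᵖ ⥤ ModuleCat.{u} K} (α : M ⟶ M') {X : D} (Z : CoinvCat ρ)
    (m : M.obj (op Z)) (g : X ⟶ Z.of) :
    mapH ρ α X (mkH ρ M X Z m g) = mkH ρ M' X Z (α.app (op Z) m) g :=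
  TensorOver.map_mk α (𝟙 (corep ρ X)) Z m g

/-- The right action of `D` on `M ⊗_E h`: `(m ⊗ g) ↦ f ↦ m ⊗ gf`. -/
def actH (X Y : D) : TensorH ρ M Y →ₗ[K] (X ⟶ Y) →ₗ[K] TensorH ρ M X :=
  LinearMap.mk₂ K (fun t f => TensorOver.map (𝟙 M) (corepMap ρ f) t)
    (fun _ _ _ => map_add _ _ _) (fun _ _ _ => map_smul _ _ _)
    (fun t f f' => by
      rw [← LinearMap.add_apply]
      congr 1
      refine TensorH.hom_ext ρ fun Z m n => ?_
      rw [LinearMap.add_apply, map_corepMap_mkH, map_corepMap_mkH, map_corepMap_mkH]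
      exact (congrArg (mkH ρ M X Z m) (Preadditive.add_comp _ _ _ f f' n)).trans (map_add _ _ _))
    (fun r t f => by
      rw [← LinearMap.smul_apply]
      congr 1
      refine TensorH.hom_ext ρ fun Z m n => ?_
      rw [LinearMap.smul_apply, map_corepMap_mkH, map_corepMap_mkH]
      exact (congrArg (mkH ρ M X Z m) (Linear.smul_comp _ _ _ r f n)).trans (map_smul _ _ _))

@[simp]
lemma actH_mkH {X Y : D} (Z : CoinvCat ρ) (m : M.obj (op Z)) (g : Y ⟶ Z.of) (f : X ⟶ Y) :
    actH ρ M X Y (mkH ρ M Y Z m g) f = mkH ρ M X Z m (f ≫ g) :=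
  map_corepMap_mkH ρ M Z m g f

lemma coactH_balanced (X : D) {Z W : CoinvCat ρ} (e : Z ⟶ W) (m : M.obj (op W))
    (n : X ⟶ Z.of) :
    (mkH ρ M X Z (M.map e.op m)).rTensor C ((ρ X Z.of).coact n) =
      (mkH ρ M X W m).rTensor C ((ρ X W.of).coact (n ≫ e.1)) := by
  have h : (ρ X W.of).coact (n ≫ e.1) =
    (Linear.rightComp K X e.1).rTensor C ((ρ X Z.of).coact n) := e.2 X n
  rw [h, ← LinearMap.rTensor_comp_apply]
  congr 2
  ext g
  exact mkH_balanced ρ M X e m g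

/-- The map `M ⊗_E Hom_D(X,-) → (M ⊗_E Hom_D(X,-)) ⊗ C`, `m ⊗ g ↦ m ⊗ g₀ ⊗ g₁`. -/
def coactH (X : D) : TensorH ρ M X →ₗ[K] TensorH ρ M X ⊗[K] C :=
  TensorH.lift ρ
    (fun Z => LinearMap.lcomp K (TensorH ρ M X ⊗[K] C) (ρ X Z.of).coact ∘ₗ
      LinearMap.rTensorHom C ∘ₗ mkH ρ M X Z)
    (coactH_balanced ρ M X)

lemma coactH_mkH {X : D} (Z : CoinvCat ρ) (m : M.obj (op Z)) (g : X ⟶ Z.of) :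
    coactH ρ M X (mkH ρ M X Z m g) = (mkH ρ M X Z m).rTensor C ((ρ X Z.of).coact g) :=
  TensorH.lift_mkH ρ _ (coactH_balanced ρ M X) Z m g

/-- The `C`-comodule structure on `M ⊗_E Hom_D(X,-)`, given by `m ⊗ g ↦ m ⊗ g₀ ⊗ g₁`. -/
def coactionH (X : D) : RightCoaction K C (TensorH ρ M X) where
  coact := coactH ρ M X
  coassoc := by
    refine TensorH.hom_ext ρ fun Z m g => ?_
    simp only [LinearMap.comp_apply, coactH_mkH, LinearEquiv.coe_coe]
    have h1 : coactH ρ M X ∘ₗ mkH ρ M X Z m =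
        (mkH ρ M X Z m).rTensor C ∘ₗ (ρ X Z.of).coact := by
      ext a; exact coactH_mkH ρ M Z m a
    rw [← LinearMap.rTensor_comp_apply, h1, LinearMap.rTensor_comp_apply,
      assoc_rTensor_rTensor, RightCoaction.coassoc_apply, rTensor_lTensor_apply]
  counit := by
    refine TensorH.hom_ext ρ fun Z m g => ?_
    simp only [LinearMap.comp_apply, coactH_mkH, LinearEquiv.coe_coe, LinearMap.id_apply]
    rw [rid_lTensor_rTensor, RightCoaction.counit_apply]

end TensorH

/-- The element `g ⊗ f` of `Hom_D(-,Y) ⊗_E Hom_D(X,-)`, for `g : Z ⟶ Y` and `f : X ⟶ Z`. -/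
def mkHH (X Y : D) (Z : CoinvCat ρ) :
    (Z.of ⟶ Y) →ₗ[K] (X ⟶ Z.of) →ₗ[K] TensorH ρ (rep ρ Y) X :=
  mkH ρ (rep ρ Y) X Z

lemma mkHH_ext {X Y : D} {P : Type*} [AddCommGroup P] [Module K P]
    {f g : TensorH ρ (rep ρ Y) X →ₗ[K] P}
    (h : ∀ (Z : CoinvCat ρ) (m : Z.of ⟶ Y) (n : X ⟶ Z.of),
      f (mkHH ρ X Y Z m n) = g (mkHH ρ X Y Z m n)) : f = g :=
  TensorH.hom_ext ρ h

lemma coactH_mkHH {X Y : D} (Z : CoinvCat ρ) (g : Z.of ⟶ Y) (f : X ⟶ Z.of) :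
    coactH ρ (rep ρ Y) X (mkHH ρ X Y Z g f) =
      (mkHH ρ X Y Z g).rTensor C ((ρ X Z.of).coact f) :=
  coactH_mkH ρ (rep ρ Y) Z g f

lemma actH_mkHH {X X' Y : D} (Z : CoinvCat ρ) (g : Z.of ⟶ Y) (f : X' ⟶ Z.of) (a : X ⟶ X') :
    actH ρ (rep ρ Y) X X' (mkHH ρ X' Y Z g f) a = mkHH ρ X Y Z g (a ≫ f) :=
  actH_mkH ρ (rep ρ Y) Z g f a

lemma can_balanced (X Y : D) {Z W : CoinvCat ρ} (e : Z ⟶ W) (m : W.of ⟶ Y) (n : X ⟶ Z.of) :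
    (compMap K X Z.of Y (e.1 ≫ m)).rTensor C ((ρ X Z.of).coact n) =
      (compMap K X W.of Y m).rTensor C ((ρ X W.of).coact (n ≫ e.1)) := by
  have h : (ρ X W.of).coact (n ≫ e.1) =
    (Linear.rightComp K X e.1).rTensor C ((ρ X Z.of).coact n) := e.2 X n
  rw [h, ← LinearMap.rTensor_comp_apply]
  congr 2
  ext g
  simp

/-- The canonical map `can_{XY} : Hom_D(-,Y) ⊗_E Hom_D(X,-) → Hom_D(X,Y) ⊗ C`,
`g ⊗ f ↦ g f₀ ⊗ f₁`. -/
def can (X Y : D) : TensorH ρ (rep ρ Y) X →ₗ[K] (X ⟶ Y) ⊗[K] C :=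
  TensorH.lift (M := rep ρ Y) ρ
    (fun Z => LinearMap.lcomp K ((X ⟶ Y) ⊗[K] C) (ρ X Z.of).coact ∘ₗ
      LinearMap.rTensorHom C ∘ₗ compMap K X Z.of Y)
    (can_balanced ρ X Y)

lemma can_mkHH {X Y : D} (Z : CoinvCat ρ) (g : Z.of ⟶ Y) (f : X ⟶ Z.of) :
    can ρ X Y (mkHH ρ X Y Z g f) = (compMap K X Z.of Y g).rTensor C ((ρ X Z.of).coact f) :=
  TensorH.lift_mkH (M := rep ρ Y) ρ _ (can_balanced ρ X Y) Z g f

/-- The left action of `D` on `h ⊗_E Hom_D(X,-)`: `g ⊗ f ↦ g'g ⊗ f`. -/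
def leftH (X : D) {Y Y' : D} (g : Y ⟶ Y') :
    TensorH ρ (rep ρ Y) X →ₗ[K] TensorH ρ (rep ρ Y') X :=
  TensorOver.map (repMap ρ g) (𝟙 (corep ρ X))

lemma leftH_mkHH {X Y Y' : D} (g' : Y ⟶ Y') (Z : CoinvCat ρ) (g : Z.of ⟶ Y) (f : X ⟶ Z.of) :
    leftH ρ X g' (mkHH ρ X Y Z g f) = mkHH ρ X Y' Z (g ≫ g') f :=
  TensorOver.map_mk (repMap ρ g') (𝟙 (corep ρ X)) Z g f

/-- The canonical map is left `D`-linear. -/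
lemma can_left {X Y Y' : D} (g : Y ⟶ Y') (t : TensorH ρ (rep ρ Y) X) :
    can ρ X Y' (leftH ρ X g t) = (Linear.rightComp K X g).rTensor C (can ρ X Y t) := by
  have : can ρ X Y' ∘ₗ leftH ρ X g = (Linear.rightComp K X g).rTensor C ∘ₗ can ρ X Y := by
    refine mkHH_ext ρ fun Z m f => ?_
    simp only [LinearMap.comp_apply]
    rw [leftH_mkHH, can_mkHH, can_mkHH, ← LinearMap.rTensor_comp_apply]
    congr 2
    ext a
    simp
  exact LinearMap.congr_fun this t

/-- The canonical map is `C`-colinear, for the coaction `id ⊗ Δ` on `Hom_D(X,Y) ⊗ C`. -/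
lemma can_colinear {X Y : D} (t : TensorH ρ (rep ρ Y) X) :
    TensorProduct.assoc K (X ⟶ Y) C C ((can ρ X Y).rTensor C (coactH ρ (rep ρ Y) X t)) =
      (Coalgebra.comul (R := K) (A := C)).lTensor (X ⟶ Y) (can ρ X Y t) := by
  have : (TensorProduct.assoc K (X ⟶ Y) C C).toLinearMap ∘ₗ (can ρ X Y).rTensor C ∘ₗ
      coactH ρ (rep ρ Y) X =
      (Coalgebra.comul (R := K) (A := C)).lTensor (X ⟶ Y) ∘ₗ can ρ X Y := by
    refine mkHH_ext ρ fun Z m g => ?_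
    simp only [LinearMap.comp_apply, coactH_mkHH, LinearEquiv.coe_coe]
    have h1 : can ρ X Y ∘ₗ mkHH ρ X Y Z m =
        (compMap K X Z.of Y m).rTensor C ∘ₗ (ρ X Z.of).coact := by
      ext a; exact can_mkHH ρ Z m a
    rw [← LinearMap.rTensor_comp_apply, h1, LinearMap.rTensor_comp_apply,
      assoc_rTensor_rTensor, RightCoaction.coassoc_apply, rTensor_lTensor_apply, can_mkHH]
  exact LinearMap.congr_fun this t

lemma can_counit {X Y : D} (Z : CoinvCat ρ) (g : Z.of ⟶ Y) (f : X ⟶ Z.of) :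
    TensorProduct.rid K (X ⟶ Y) ((Coalgebra.counit (R := K) (A := C)).lTensor (X ⟶ Y)
      (can ρ X Y (mkHH ρ X Y Z g f))) = f ≫ g := by
  rw [can_mkHH, rid_lTensor_rTensor, RightCoaction.counit_apply, compMap_apply]

/-- `D` is a `C`-Galois extension of its category `E` of coinvariants: each canonical map
`can_X : h ⊗_E Hom_D(X,-) → Hom_D(X,-) ⊗ C` is an isomorphism. (It is left `D`-linear and
`C`-colinear, see `can_left` and `can_colinear`, so it is an isomorphism of left
`D`-modules and of objectwise `C`-comodules if and only if each `can_{XY}` is bijective.) -/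
def IsGaloisExtension : Prop := ∀ X Y : D, Function.Bijective (can ρ X Y)

end Galois

/-! ### The canonical entwining structure of a Galois extension -/

section Canonical

variable {K : Type w₁} [Field K] {C : Type w₂} [AddCommGroup C] [Module K C] [Coalgebra K C]
variable {D : Type u} [Category.{u} D] [Preadditive D] [Linear K D]
variable {ρ : ∀ X Y : D, RightCoaction K C (X ⟶ Y)} (hG : IsGaloisExtension ρ)

/-- The canonical map of a Galois extension, as an isomorphism. -/
def canEquiv (X Y : D) : TensorH ρ (rep ρ Y) X ≃ₗ[K] (X ⟶ Y) ⊗[K] C :=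
  LinearEquiv.ofBijective (can ρ X Y) (hG X Y)

lemma canEquiv_apply (X Y : D) (t : TensorH ρ (rep ρ Y) X) : canEquiv hG X Y t = can ρ X Y t := rfl

/-- The translation map `τ_X : C → Hom_D(-,X) ⊗_E Hom_D(X,-)`, `c ↦ can⁻¹(id ⊗ c)`. -/
def translation (X : D) : C →ₗ[K] TensorH ρ (rep ρ X) X :=
  (canEquiv hG X X).symm.toLinearMap ∘ₗ TensorProduct.mk K (X ⟶ X) C (𝟙 X)

lemma can_translation (X : D) (c : C) : can ρ X X (translation hG X c) = 𝟙 X ⊗ₜ c :=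
  (canEquiv hG X X).apply_symm_apply _

/-- The canonical entwining maps: the composites
`C ⊗ Hom(X,Y) → (Hom(-,Y) ⊗_E Hom(Y,-)) ⊗ Hom(X,Y) → Hom(-,Y) ⊗_E Hom(X,-) → Hom(X,Y) ⊗ C`
of `τ_Y ⊗ id`, composition, and `can_{XY}`. -/
def canonicalPsi (X Y : D) : C ⊗[K] (X ⟶ Y) →ₗ[K] (X ⟶ Y) ⊗[K] C :=
  can ρ X Y ∘ₗ TensorProduct.lift (actH ρ (rep ρ Y) X Y ∘ₗ translation hG Y)

lemma canonicalPsi_tmul {X Y : D} (c : C) (f : X ⟶ Y) :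
    canonicalPsi hG X Y (c ⊗ₜ f) = can ρ X Y (actH ρ (rep ρ Y) X Y (translation hG Y c) f) := rfl

variable (ρ) in
lemma actH_leftH {X X' Y Y' : D} (g : Y ⟶ Y') (a : X ⟶ X') (t : TensorH ρ (rep ρ Y) X') :
    actH ρ (rep ρ Y') X X' (leftH ρ X' g t) a = leftH ρ X g (actH ρ (rep ρ Y) X X' t a) := by
  have : (actH ρ (rep ρ Y') X X').flip a ∘ₗ leftH ρ X' g =
      leftH ρ X g ∘ₗ (actH ρ (rep ρ Y) X X').flip a := by
    refine mkHH_ext ρ fun Z m f => ?_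
    simp only [LinearMap.comp_apply, LinearMap.flip_apply]
    rw [leftH_mkHH, actH_mkHH, actH_mkHH, leftH_mkHH]
  exact LinearMap.congr_fun this t

lemma can_actH {X X' Y : D} (a : X ⟶ X') (t : TensorH ρ (rep ρ Y) X') :
    can ρ X Y (actH ρ (rep ρ Y) X X' t a) =
      twist (canonicalPsi hG X X') (compMap K X X' Y) a (can ρ X' Y t) := by
  obtain ⟨x, rfl⟩ := (canEquiv hG X' Y).symm.surjective t
  rw [← canEquiv_apply hG X' Y, LinearEquiv.apply_symm_apply]
  induction x using TensorProduct.induction_on with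
  | zero => simp
  | add x y hx hy => simp only [map_add, LinearMap.add_apply, hx, hy]
  | tmul g c =>
    have h : (canEquiv hG X' Y).symm (g ⊗ₜ c) = leftH ρ X' g (translation hG X' c) := by
      rw [LinearEquiv.symm_apply_eq, canEquiv_apply, can_left, can_translation]
      simp
    rw [h, actH_leftH, can_left, twist_tmul, canonicalPsi_tmul]
    rfl

/-- `ρ(gf) = g₀ f_ψ ⊗ g₁^ψ`: with the coactions `ρ`, the right `D`-module `Hom_D(-,Z)` satisfies the
compatibility condition of an entwined module for the canonical `ψ`. -/
lemma coact_comp {X Y Z : D} (f : X ⟶ Y) (g : Y ⟶ Z) :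
    (ρ X Z).coact (f ≫ g) =
      twist (canonicalPsi hG X Y) (compMap K X Y Z) f ((ρ Y Z).coact g) := by
  have key : ∀ {W : D} (h : W ⟶ Z), can ρ W Z (mkHH ρ W Z ⟨Z⟩ (𝟙 Z) h) = (ρ W Z).coact h := by
    intro W h
    rw [can_mkHH]
    have : compMap K W Z Z (𝟙 Z) = LinearMap.id := by ext; simp
    rw [this, LinearMap.rTensor_id_apply]
  rw [← key, ← key, ← can_actH, actH_mkHH]

lemma coactH_actH (M : (CoinvCat ρ)ᵒᵖ ⥤ ModuleCat.{u} K) {X Y : D} (f : X ⟶ Y)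
    (t : TensorH ρ M Y) :
    coactH ρ M X (actH ρ M X Y t f) =
      twist (canonicalPsi hG X Y) (actH ρ M X Y) f (coactH ρ M Y t) := by
  have : coactH ρ M X ∘ₗ (actH ρ M X Y).flip f =
      twist (canonicalPsi hG X Y) (actH ρ M X Y) f ∘ₗ coactH ρ M Y := by
    refine TensorH.hom_ext ρ fun Z m g => ?_
    simp only [LinearMap.comp_apply, LinearMap.flip_apply]
    rw [actH_mkH, coactH_mkH, coactH_mkH, coact_comp hG]
    refine twist_natural _ _ _ (mkH ρ M Y Z m) (mkH ρ M X Z m) (fun n g => ?_) f _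
    rw [actH_mkH, compMap_apply]
  exact LinearMap.congr_fun this t

lemma coactH_translation (X : D) (c : C) :
    coactH ρ (rep ρ X) X (translation hG X c) =
      (translation hG X).rTensor C (Coalgebra.comul (R := K) c) := by
  apply ((canEquiv hG X X).rTensor C).injective
  change (can ρ X X).rTensor C _ = (can ρ X X).rTensor C _
  apply (TensorProduct.assoc K (X ⟶ X) C C).injective
  rw [can_colinear, can_translation, ← LinearMap.rTensor_comp_apply]
  have h : can ρ X X ∘ₗ translation hG X = TensorProduct.mk K (X ⟶ X) C (𝟙 X) := by
    ext c; exact can_translation hG X c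
  rw [h, LinearMap.lTensor_tmul]
  generalize Coalgebra.comul (R := K) c = x
  induction x using TensorProduct.induction_on with
  | zero => simp
  | add x y hx hy => simp only [map_add, TensorProduct.tmul_add, hx, hy]
  | tmul a b => simp

/-- The canonical entwining structure `(D, C, ψ)` of a `C`-Galois extension. -/
def canonicalEntwining : EntwiningStructure K C D where
  psi := canonicalPsi hG
  psi_comp {X Y Z} f g c := by
    rw [canonicalPsi_tmul, canonicalPsi_tmul, ← can_actH]
    congr 1
    have : (actH ρ (rep ρ Z) X Z).flip (f ≫ g) =
        (actH ρ (rep ρ Z) X Y).flip f ∘ₗ (actH ρ (rep ρ Z) Y Z).flip g := by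
      refine mkHH_ext ρ fun W m n => ?_
      simp only [LinearMap.comp_apply, LinearMap.flip_apply, actH_mkHH, Category.assoc]
    exact LinearMap.congr_fun this _
  psi_counit {X Y} f c := by
    have h1 : ∀ t : TensorH ρ (rep ρ Y) Y,
        TensorProduct.rid K (X ⟶ Y) ((Coalgebra.counit (R := K) (A := C)).lTensor (X ⟶ Y)
          (can ρ X Y (actH ρ (rep ρ Y) X Y t f))) =
        Linear.leftComp K Y f (TensorProduct.rid K (Y ⟶ Y)
          ((Coalgebra.counit (R := K) (A := C)).lTensor (Y ⟶ Y) (can ρ Y Y t))) := by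
      intro t
      have : (TensorProduct.rid K (X ⟶ Y)).toLinearMap ∘ₗ
          (Coalgebra.counit (R := K) (A := C)).lTensor (X ⟶ Y) ∘ₗ
          can ρ X Y ∘ₗ (actH ρ (rep ρ Y) X Y).flip f =
          Linear.leftComp K Y f ∘ₗ (TensorProduct.rid K (Y ⟶ Y)).toLinearMap ∘ₗ
          (Coalgebra.counit (R := K) (A := C)).lTensor (Y ⟶ Y) ∘ₗ can ρ Y Y := by
        refine mkHH_ext ρ fun W m n => ?_
        simp only [LinearMap.comp_apply, LinearMap.flip_apply, actH_mkHH, LinearEquiv.coe_coe,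
          can_counit, Linear.leftComp_apply, Category.assoc]
      exact LinearMap.congr_fun this t
    rw [canonicalPsi_tmul, h1, can_translation]
    simp
  psi_comul {X Y} f c := by
    rw [canonicalPsi_tmul, ← can_colinear, coactH_actH hG, coactH_translation]
    congr 1
    generalize Coalgebra.comul (R := K) c = x
    induction x using TensorProduct.induction_on with
    | zero => simp
    | add x y hx hy => simp only [map_add, TensorProduct.add_tmul, hx, hy]
    | tmul a b =>
      rw [LinearMap.rTensor_tmul, twist_tmul, TensorProduct.assoc_tmul, LinearMap.lTensor_tmul,
        ← LinearMap.rTensor_comp_apply]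
      generalize canonicalPsi hG X Y (b ⊗ₜ f) = y
      induction y using TensorProduct.induction_on with
      | zero => simp
      | add x y hx hy => simp only [map_add, TensorProduct.tmul_add, hx, hy]
      | tmul g d =>
        rw [TensorProduct.assoc_symm_tmul, LinearMap.rTensor_tmul, LinearMap.rTensor_tmul,
          canonicalPsi_tmul]
        rfl
  psi_id X c := by
    have : (actH ρ (rep ρ X) X X).flip (𝟙 X) = LinearMap.id := by
      refine mkHH_ext ρ fun W m n => ?_
      simp only [LinearMap.flip_apply, LinearMap.id_apply, actH_mkHH, Category.id_comp]
    have h := LinearMap.congr_fun this (translation hG X c)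
    simp only [LinearMap.flip_apply, LinearMap.id_apply] at h
    rw [canonicalPsi_tmul, h, can_translation]

/-! ### The functors `M ↦ M ⊗_E h` and `N ↦ N^co` -/

variable (ρ) in
/-- The right `D`-module `M ⊗_E h`: `X ↦ M ⊗_E Hom_D(X,-)`, with `(m ⊗ g)·f = m ⊗ gf`. -/
def tensorMod (M : RightMod K (CoinvCat ρ)) : RightMod K D where
  obj :=
    { obj := fun X => ModuleCat.of K (TensorH ρ M.obj X.unop)
      map := fun {Y X} f => ModuleCat.ofHom ((actH ρ M.obj X.unop Y.unop).flip f.unop)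
      map_id := fun X => by
        ext1
        refine TensorH.hom_ext ρ fun Z m g => ?_
        change actH ρ M.obj X.unop X.unop (mkH ρ M.obj X.unop Z m g) (𝟙 X.unop) = _
        rw [actH_mkH, Category.id_comp]
        rfl
      map_comp := fun {X Y W} f f' => by
        ext1
        refine TensorH.hom_ext ρ fun Z m g => ?_
        change actH ρ M.obj W.unop X.unop (mkH ρ M.obj X.unop Z m g) (f'.unop ≫ f.unop) =
          actH ρ M.obj W.unop Y.unop
            (actH ρ M.obj Y.unop X.unop (mkH ρ M.obj X.unop Z m g) f.unop) f'.unop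
        rw [actH_mkH, actH_mkH, actH_mkH, Category.assoc] }
  property :=
    ⟨fun f g => ModuleCat.hom_ext (map_add (actH ρ M.obj _ _).flip f g),
      fun r f => ModuleCat.hom_ext (map_smul (actH ρ M.obj _ _).flip r f)⟩

/-- The entwined module `M ⊗_E h`, with coaction `m ⊗ g ↦ m ⊗ g₀ ⊗ g₁`. -/
def tensorEntwined (M : RightMod K (CoinvCat ρ)) : EntwinedModule (canonicalEntwining hG) where
  toMod := tensorMod ρ M
  coaction X := coactionH ρ M.obj X
  compat f t := coactH_actH hG M.obj f t

/-- The functor `Mod-E ⥤ M(ψ)`, `M ↦ M ⊗_E h`; on morphisms, `α ↦ α ⊗ id`. -/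
def tensorFunctor : RightMod K (CoinvCat ρ) ⥤ EntwinedModule (canonicalEntwining hG) where
  obj M := tensorEntwined hG M
  map {M N} α :=
    { hom := ObjectProperty.homMk
        { app := fun X => ModuleCat.ofHom (mapH ρ α.hom X.unop)
          naturality := fun Y X f => by
            ext1
            refine TensorH.hom_ext ρ fun Z m g => ?_
            change mapH ρ α.hom X.unop
                (actH ρ M.obj X.unop Y.unop (mkH ρ M.obj Y.unop Z m g) f.unop) =
              actH ρ N.obj X.unop Y.unop (mapH ρ α.hom Y.unop (mkH ρ M.obj Y.unop Z m g)) f.unop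
            rw [actH_mkH, mapH_mkH, mapH_mkH, actH_mkH] }
      colinear := fun X t => by
        have : coactH ρ N.obj X ∘ₗ mapH ρ α.hom X =
            (mapH ρ α.hom X).rTensor C ∘ₗ coactH ρ M.obj X := by
          refine TensorH.hom_ext ρ fun Z m g => ?_
          rw [LinearMap.comp_apply, LinearMap.comp_apply, mapH_mkH, coactH_mkH, coactH_mkH,
            ← LinearMap.rTensor_comp_apply]
          congr 2
          ext g
          exact (mapH_mkH ρ α.hom Z m g).symm
        exact LinearMap.congr_fun this t }
  map_id M := by
    apply EntwinedModule.Hom.ext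
    ext X : 4
    refine TensorH.hom_ext ρ fun Z m g => ?_
    exact mapH_mkH ρ (𝟙 M.obj) Z m g
  map_comp {M N P} α β := by
    apply EntwinedModule.Hom.ext
    ext X : 4
    refine TensorH.hom_ext ρ fun Z m g => ?_
    change mapH ρ (α.hom ≫ β.hom) X.unop (mkH ρ M.obj X.unop Z m g) =
      mapH ρ β.hom X.unop (mapH ρ α.hom X.unop (mkH ρ M.obj X.unop Z m g))
    rw [mapH_mkH, mapH_mkH, mapH_mkH]
    rfl

variable {hG}

/-- The space of coinvariants of an entwined module `N` at `X`:
`{n ∈ N(X) | ρ(n) = N(id₀)(n) ⊗ id₁}`, where `ρ(id_X) = id₀ ⊗ id₁`. This is the space of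
coinvariants with respect to the group-like family `ρ(id_X)` of the coring `h ⊗ C`, under
`N ⊗_D (h ⊗ C) ≅ N ⊗ C`, `n ⊗ (f ⊗ c) ↦ N(f)(n) ⊗ c`. -/
def coinvSubmodule (N : EntwinedModule (canonicalEntwining hG)) (X : D) :
    Submodule K (N.toMod.obj.obj (op X) : Type u) where
  carrier := {n | (N.coaction X).coact n =
    (N.toMod.action X X n).rTensor C ((ρ X X).coact (𝟙 X))}
  zero_mem' := by simp
  add_mem' := fun {a b} ha hb => by
    change (N.coaction X).coact (a + b) = (N.toMod.action X X (a + b)).rTensor C _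
    change (N.coaction X).coact a = _ at ha
    change (N.coaction X).coact b = _ at hb
    rw [map_add, map_add, LinearMap.rTensor_add, LinearMap.add_apply, ha, hb]
  smul_mem' := fun r a ha => by
    change (N.coaction X).coact (r • a) = (N.toMod.action X X (r • a)).rTensor C _
    change (N.coaction X).coact a = _ at ha
    rw [map_smul, map_smul, LinearMap.rTensor_smul, LinearMap.smul_apply, ha]

lemma mem_coinvSubmodule (N : EntwinedModule (canonicalEntwining hG)) {X : D}
    (n : N.toMod.obj.obj (op X)) :
    n ∈ coinvSubmodule N X ↔
      (N.coaction X).coact n = (N.toMod.action X X n).rTensor C ((ρ X X).coact (𝟙 X)) :=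
  Iff.rfl

/-- Coinvariants are stable under the morphisms of `E`. -/
lemma coinvSubmodule_map (N : EntwinedModule (canonicalEntwining hG)) {X Y : CoinvCat ρ}
    (f : X ⟶ Y) (n : N.toMod.obj.obj (op Y.of)) (hn : n ∈ coinvSubmodule N Y.of) :
    N.toMod.obj.map (Quiver.Hom.op f.1) n ∈ coinvSubmodule N X.of := by
  have hact : ∀ {U V W : D} (a : U ⟶ V) (b : V ⟶ W) (n : N.toMod.obj.obj (op W)),
      N.toMod.action U V (N.toMod.action V W n b) a = N.toMod.action U W n (a ≫ b) := by
    intro U V W a b n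
    simp only [RightMod.action_apply, op_comp, Functor.map_comp, ConcreteCategory.comp_apply]
  rw [mem_coinvSubmodule] at hn ⊢
  rw [N.compat, hn]
  have h1 := twist_natural ((canonicalEntwining hG).psi X.of Y.of) (compMap K X.of Y.of Y.of)
    (N.toMod.action X.of Y.of) (N.toMod.action Y.of Y.of n) (N.toMod.action X.of Y.of n)
    (fun b a => (hact a b n).symm) f.1 ((ρ Y.of Y.of).coact (𝟙 Y.of))
  have h2 := coact_comp hG f.1 (𝟙 Y.of)
  have h3 : (ρ X.of Y.of).coact (𝟙 X.of ≫ f.1) =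
    (Linear.rightComp K X.of f.1).rTensor C ((ρ X.of X.of).coact (𝟙 X.of)) := f.2 X.of (𝟙 X.of)
  rw [Category.comp_id] at h2
  rw [Category.id_comp] at h3
  change _ = twist ((canonicalEntwining hG).psi X.of Y.of) _ _ _ at h2
  rw [← h1, ← h2, h3, ← LinearMap.rTensor_comp_apply]
  congr 2
  ext a
  exact (hact a f.1 n).symm

/-- The right `E`-module `N^co` of coinvariants of an entwined module `N`. -/
def coinvMod (N : EntwinedModule (canonicalEntwining hG)) : RightMod K (CoinvCat ρ) where
  obj :=
    { obj := fun X => ModuleCat.of K (coinvSubmodule N X.unop.of)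
      map := fun {Y X} f => ModuleCat.ofHom
        ((N.toMod.obj.map (Quiver.Hom.op f.unop.1)).hom.restrict
          (fun n hn => coinvSubmodule_map N f.unop n hn))
      map_id := fun X => by
        ext n
        exact ConcreteCategory.congr_hom (N.toMod.obj.map_id (op X.unop.of)) n.1
      map_comp := fun {X Y Z} f g => by
        ext n
        exact ConcreteCategory.congr_hom (N.toMod.obj.map_comp
          (Quiver.Hom.op f.unop.1) (Quiver.Hom.op g.unop.1)) n.1 }
  property := by
    constructor
    · intro X Y f g
      ext n
      exact ConcreteCategory.congr_hom (N.toMod.property.1 f.1 g.1) n.1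
    · intro X Y r f
      ext n
      exact ConcreteCategory.congr_hom (N.toMod.property.2 r f.1) n.1

variable (hG) in
/-- The functor of coinvariants `M(ψ) ⥤ Mod-E`, `N ↦ N^co`; on morphisms, restriction. -/
def coinvFunctor : EntwinedModule (canonicalEntwining hG) ⥤ RightMod K (CoinvCat ρ) where
  obj N := coinvMod N
  map {N P} η := ObjectProperty.homMk
    { app := fun X => ModuleCat.ofHom
        ((η.hom.hom.app (op X.unop.of)).hom.restrict (fun n hn => by
          have h1 : (P.coaction X.unop.of).coact ((η.hom.hom.app (op X.unop.of)).hom n) = _ :=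
            η.colinear X.unop.of n
          rw [mem_coinvSubmodule] at hn ⊢
          rw [h1, hn, ← LinearMap.rTensor_comp_apply]
          congr 2
          ext a
          exact ConcreteCategory.congr_hom (η.hom.hom.naturality a.op) n))
      naturality := fun Y X f => by
        ext n
        apply Subtype.ext
        exact ConcreteCategory.congr_hom
          (η.hom.hom.naturality (Quiver.Hom.op f.unop.1)) n.1 }
  map_id _ := rfl
  map_comp _ _ := rfl

end Canonical

/-! ### Convolution -/

section Convolution

variable {K : Type w₁} [Field K] {C : Type w₂} [AddCommGroup C] [Module K C] [Coalgebra K C]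
variable {D : Type u} [Category.{u} D] [Preadditive D] [Linear K D]

/-- The convolution product `(φ * θ)(c) = φ(c₁) ∘ θ(c₂)` of linear maps `φ : C → Hom(Y,Z)` and
`θ : C → Hom(X,Y)`. -/
def convolution {X Y Z : D} (φ : C →ₗ[K] (Y ⟶ Z)) (θ : C →ₗ[K] (X ⟶ Y)) : C →ₗ[K] (X ⟶ Z) :=
  TensorProduct.lift (compMap K X Y Z) ∘ₗ TensorProduct.map φ θ ∘ₗ Coalgebra.comul

/-- A collection `Φ` of linear maps `Φ_{XY} : C → Hom(X,Y)` is convolution invertible if there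
are linear maps `Φ'_{XY} : C → Hom(X,Y)` with
`(Φ_{XY} * Φ'_{YX})(c) = ε(c) id_Y = (Φ'_{XY} * Φ_{YX})(c)`. -/
def IsConvolutionInvertible (Φ : ∀ X Y : D, C →ₗ[K] (X ⟶ Y)) : Prop :=
  ∃ Φ' : ∀ X Y : D, C →ₗ[K] (X ⟶ Y), ∀ (X Y : D) (c : C),
    convolution (Φ X Y) (Φ' Y X) c = Coalgebra.counit (R := K) c • 𝟙 Y ∧
    convolution (Φ' X Y) (Φ Y X) c = Coalgebra.counit (R := K) c • 𝟙 Y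

end Convolution

end

end CatGalois

/-!
The two functors are related by the natural transformations `M → (M ⊗_E h)^co`, `m ↦ m ⊗ id`, and
`N^co ⊗_E h → N`, `n ⊗ g ↦ n·g`. It suffices to show that both are objectwise bijective, and their
inverses can be written down with a convolution inverse `Φ'` of `Φ`.

The main point is that `n ↦ n₀·Φ'(n₁)` maps an entwined module `N` to its coinvariants
(`EntwinedModule.proj_mem`). By the compatibility of action and coaction this reduces to
`ψ(c₁ ⊗ Φ'(c₂)) = Φ'(c)·ρ(id)` (`IsCleaving.conv_psi`), an identity between two linear maps on `C`
which agree after convolution with the invertible `Φ`: since `Φ` is colinear, both become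
`ε(c) ρ(id)`. For `N = Hom_D(-,V)` the coinvariants are morphisms of `E`, so `g ↦ g₀Φ'(g₁)` is a map
from morphisms of `D` to morphisms of `E` (`projE`).

* The inverse of `N^co ⊗_E h → N` is `n ↦ n₀·Φ'(n₁) ⊗ Φ(n₂)`. On `n·g` with `n` coinvariant it
  gives `n·(g₀Φ'(g₁)) ⊗ Φ(g₂)`, and the factor `g₀Φ'(g₁)` from `E` can be moved across the tensor
  sign (`EntwinedModule.counitMap_bijective`).
* For the other map let `q(m ⊗ g) = m·(g₀Φ'(g₁))`. Then `q(t) ⊗ id = t₀·Φ'(t₁)`, while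
  `(t·Φ(c))₀·Φ'((t·Φ(c))₁) = ε(c) t` for coinvariant `t`. If `ε(c) = 1`, it follows that
  `t ↦ q(t·Φ(c))` is inverse to `m ↦ m ⊗ id` (`unitMap_bijective`). If there is no such `c`, then
  `ε = 0`, and all comodules vanish.
-/

namespace CatGalois

noncomputable section

/-! ### Convolution along a coaction -/

section Conv

variable {K : Type w₁} [Field K] {C : Type w₂} [AddCommGroup C] [Module K C] [Coalgebra K C]
variable {N N' H H₁ H₂ H₃ P Q : Type*} [AddCommGroup N] [Module K N] [AddCommGroup N'] [Module K N']
  [AddCommGroup H] [Module K H] [AddCommGroup H₁] [Module K H₁] [AddCommGroup H₂] [Module K H₂]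
  [AddCommGroup H₃] [Module K H₃] [AddCommGroup P] [Module K P] [AddCommGroup Q] [Module K Q]

/-- The map `n ↦ b(n₀, θ(n₁))` on a comodule `N`, for a bilinear map `b : N → H → P` and a linear
map `θ : C → H`. For `N = C` and `b = m ∘ φ` this is the convolution product of `φ` and `θ` with
respect to the bilinear map `m`. -/
def RightCoaction.conv (ρ : RightCoaction K C N) (b : N →ₗ[K] H →ₗ[K] P) (θ : C →ₗ[K] H) :
    N →ₗ[K] P :=
  TensorProduct.lift (b.compl₂ θ) ∘ₗ ρ.coact

lemma RightCoaction.conv_apply (ρ : RightCoaction K C N) (b : N →ₗ[K] H →ₗ[K] P) (θ : C →ₗ[K] H)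
    (n : N) : ρ.conv b θ n = TensorProduct.lift (b.compl₂ θ) (ρ.coact n) := rfl

/-- Associativity of convolution: if `b₂(b₁(n, φ(c)), k) = b₃(n, m(c, k))`, then
`b₂(b₁(n₀, φ(n₁)), θ(n₂)) = b₃(n₀, m(n₁, θ(n₂)))`. -/
lemma RightCoaction.conv_assoc (ρ : RightCoaction K C N) (b₁ : N →ₗ[K] H₁ →ₗ[K] P)
    (b₂ : P →ₗ[K] H₂ →ₗ[K] Q) (b₃ : N →ₗ[K] H₃ →ₗ[K] Q) (φ : C →ₗ[K] H₁) (θ : C →ₗ[K] H₂)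
    (m : C →ₗ[K] H₂ →ₗ[K] H₃) (h : ∀ n c k, b₂ (b₁ n (φ c)) k = b₃ n (m c k)) :
    ρ.conv (b₂ ∘ₗ ρ.conv b₁ φ) θ = ρ.conv b₃ ((regularCoaction K C).conv m θ) := by
  have h₁ : TensorProduct.lift ((b₂ ∘ₗ ρ.conv b₁ φ).compl₂ θ) =
      TensorProduct.lift ((b₂ ∘ₗ TensorProduct.lift (b₁.compl₂ φ)).compl₂ θ) ∘ₗ
        ρ.coact.rTensor C := by
    ext; rfl
  have h₂ : TensorProduct.lift (b₃.compl₂ ((regularCoaction K C).conv m θ)) =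
      TensorProduct.lift (b₃.compl₂ (TensorProduct.lift (m.compl₂ θ))) ∘ₗ
        (Coalgebra.comul (R := K) (A := C)).lTensor N := by
    ext; rfl
  have h₃ : TensorProduct.lift ((b₂ ∘ₗ TensorProduct.lift (b₁.compl₂ φ)).compl₂ θ) =
      TensorProduct.lift (b₃.compl₂ (TensorProduct.lift (m.compl₂ θ))) ∘ₗ
        (TensorProduct.assoc K N C C).toLinearMap := by
    apply TensorProduct.ext_threefold
    intro n c d
    exact h n c (θ d)
  ext n
  rw [conv_apply, conv_apply, h₁, h₂, h₃]
  simp only [LinearMap.comp_apply, LinearEquiv.coe_coe]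
  rw [ρ.coassoc_apply]

/-- `b(n₀, ε(n₁)h) = b(n, h)`. -/
lemma RightCoaction.conv_counit (ρ : RightCoaction K C N) (b : N →ₗ[K] H →ₗ[K] P) (h : H) :
    ρ.conv b ((Coalgebra.counit (R := K) (A := C)).smulRight h) = b.flip h := by
  have h₁ : TensorProduct.lift
        (b.compl₂ ((Coalgebra.counit (R := K) (A := C)).smulRight h)) =
      b.flip h ∘ₗ (TensorProduct.rid K N).toLinearMap ∘ₗ
        (Coalgebra.counit (R := K) (A := C)).lTensor N := by
    ext; simp
  ext n
  rw [conv_apply, h₁]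
  simp only [LinearMap.comp_apply, LinearEquiv.coe_coe]
  rw [ρ.counit_apply]

/-- `ε(c₁) f(θ(c₂)) = f(θ(c))`. -/
lemma counit_conv (f : H →ₗ[K] P) (θ : C →ₗ[K] H) :
    (regularCoaction K C).conv ((Coalgebra.counit (R := K) (A := C)).smulRight f) θ = f ∘ₗ θ := by
  have h₁ : TensorProduct.lift
        (((Coalgebra.counit (R := K) (A := C)).smulRight f).compl₂ θ) =
      (f ∘ₗ θ) ∘ₗ (TensorProduct.lid K C).toLinearMap ∘ₗ
        (Coalgebra.counit (R := K) (A := C)).rTensor C := by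
    ext; simp
  ext c
  rw [RightCoaction.conv_apply, h₁]
  change (f ∘ₗ θ) (TensorProduct.lid K C ((Coalgebra.counit (R := K) (A := C)).rTensor C
    (Coalgebra.comul (R := K) c))) = _
  rw [Coalgebra.rTensor_counit_comul]
  simp

lemma RightCoaction.map_conv (ρ : RightCoaction K C N) (b : N →ₗ[K] H →ₗ[K] P) (θ : C →ₗ[K] H)
    (f : P →ₗ[K] Q) (n : N) : f (ρ.conv b θ n) = ρ.conv (b.compr₂ f) θ n := by
  have : f ∘ₗ TensorProduct.lift (b.compl₂ θ) = TensorProduct.lift ((b.compr₂ f).compl₂ θ) := by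
    ext; rfl
  exact LinearMap.congr_fun this (ρ.coact n)

lemma RightCoaction.conv_of_coact_eq (ρ : RightCoaction K C N) (ρ' : RightCoaction K C N')
    (b : N →ₗ[K] H →ₗ[K] P) (θ : C →ₗ[K] H) {k : N' →ₗ[K] N} {n : N} {n' : N'}
    (h : ρ.coact n = k.rTensor C (ρ'.coact n')) : ρ.conv b θ n = ρ'.conv (b ∘ₗ k) θ n' := by
  have : TensorProduct.lift (b.compl₂ θ) ∘ₗ k.rTensor C =
      TensorProduct.lift ((b ∘ₗ k).compl₂ θ) := by
    ext; rfl
  rw [conv_apply, h]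
  exact LinearMap.congr_fun this (ρ'.coact n')

/-- The map `k(n₀) ⊗ n₁` is itself of the form `conv`, so that `conv_assoc` applies to it. -/
lemma RightCoaction.conv_mk (ρ : RightCoaction K C N) (k : N →ₗ[K] P) :
    ρ.conv (TensorProduct.mk K P C ∘ₗ k) LinearMap.id = k.rTensor C ∘ₗ ρ.coact := by
  have : TensorProduct.lift ((TensorProduct.mk K P C ∘ₗ k).compl₂ LinearMap.id) =
      k.rTensor C := by
    ext; rfl
  rw [conv, this]

/-- If the counit of `C` vanishes, then so does every comodule over `C`. -/
lemma RightCoaction.eq_zero_of_counit (ρ : RightCoaction K C N)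
    (h : (Coalgebra.counit (R := K) (A := C)) = 0) (n : N) : n = 0 := by
  rw [← ρ.counit_apply n, h]
  simp

end Conv

section

variable {K : Type w₁} [Field K] {C : Type w₂} [AddCommGroup C] [Module K C]
variable {D : Type u} [Category.{u} D] [Preadditive D] [Linear K D]

/-- The map `twist ψ b` as a bilinear map `N ⊗ C → Hom(X,Y) → P ⊗ C`. -/
def twistBilin {X Y : D} (ψ : C ⊗[K] (X ⟶ Y) →ₗ[K] (X ⟶ Y) ⊗[K] C)
    {N P : Type*} [AddCommGroup N] [Module K N] [AddCommGroup P] [Module K P]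
    (b : N →ₗ[K] (X ⟶ Y) →ₗ[K] P) : N ⊗[K] C →ₗ[K] (X ⟶ Y) →ₗ[K] P ⊗[K] C :=
  TensorProduct.lift ((LinearMap.llcomp K (X ⟶ Y) ((X ⟶ Y) ⊗[K] C) (P ⊗[K] C)).compl₁₂
    (LinearMap.rTensorHom C ∘ₗ b) (TensorProduct.curry ψ))

lemma twistBilin_apply {X Y : D} (ψ : C ⊗[K] (X ⟶ Y) →ₗ[K] (X ⟶ Y) ⊗[K] C)
    {N P : Type*} [AddCommGroup N] [Module K N] [AddCommGroup P] [Module K P]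
    (b : N →ₗ[K] (X ⟶ Y) →ₗ[K] P) (x : N ⊗[K] C) (f : X ⟶ Y) :
    twistBilin ψ b x f = twist ψ b f x := by
  induction x using TensorProduct.induction_on with
  | zero => simp
  | add x y hx hy => simp only [map_add, LinearMap.add_apply, hx, hy]
  | tmul n c => rfl

variable [Coalgebra K C]

lemma convolution_eq_conv {X Y Z : D} (φ : C →ₗ[K] (Y ⟶ Z)) (θ : C →ₗ[K] (X ⟶ Y)) :
    convolution φ θ = (regularCoaction K C).conv (compMap K X Y Z ∘ₗ φ) θ := by
  have : TensorProduct.lift (compMap K X Y Z) ∘ₗ TensorProduct.map φ θ =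
      TensorProduct.lift ((compMap K X Y Z ∘ₗ φ).compl₂ θ) := by
    ext; rfl
  rw [RightCoaction.conv, ← this]
  rfl

end

section Cleft

variable {K : Type w₁} [Field K] {C : Type w₂} [AddCommGroup C] [Module K C] [Coalgebra K C]
variable {D : Type u} [Category.{u} D] [Preadditive D] [Linear K D]
variable {ρ : ∀ X Y : D, RightCoaction K C (X ⟶ Y)}

/-! ### The entwining map on a convolution inverse -/

/-- `Φ` is a collection of colinear maps with convolution inverse `Φ'`. -/
structure IsCleaving (ρ : ∀ X Y : D, RightCoaction K C (X ⟶ Y))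
    (Φ Φ' : ∀ X Y : D, C →ₗ[K] (X ⟶ Y)) : Prop where
  colinear : ∀ X Y : D, IsColinear (regularCoaction K C) (ρ X Y) (Φ X Y)
  conv_right : ∀ X Y : D, (regularCoaction K C).conv (compMap K Y X Y ∘ₗ Φ X Y) (Φ' Y X) =
    (Coalgebra.counit (R := K) (A := C)).smulRight (𝟙 Y)
  conv_left : ∀ X Y : D, (regularCoaction K C).conv (compMap K Y X Y ∘ₗ Φ' X Y) (Φ Y X) =
    (Coalgebra.counit (R := K) (A := C)).smulRight (𝟙 Y)

variable (hG : IsGaloisExtension ρ) {Φ Φ' : ∀ X Y : D, C →ₗ[K] (X ⟶ Y)} (hΦ : IsCleaving ρ Φ Φ')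

include hΦ in
/-- `Φ(c₁)·ψ(c₂ ⊗ Φ'(c₃)) = ε(c) ρ(id)`: by colinearity of `Φ` the left side is
`ρ(Φ(c₁)Φ'(c₂))`. -/
lemma IsCleaving.conv_conv_psi (X Y : D) :
    (regularCoaction K C).conv (LinearMap.rTensorHom C ∘ₗ compMap K X Y X ∘ₗ Φ Y X)
      ((regularCoaction K C).conv (TensorProduct.curry (canonicalPsi hG X Y)) (Φ' X Y)) =
    (Coalgebra.counit (R := K) (A := C)).smulRight ((ρ X X).coact (𝟙 X)) := by
  rw [← (regularCoaction K C).conv_assoc (TensorProduct.mk K (Y ⟶ X) C ∘ₗ Φ Y X)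
    (twistBilin (canonicalPsi hG X Y) (compMap K X Y X)) _ LinearMap.id _ _ (fun n c k => rfl),
    RightCoaction.conv_mk]
  have h₁ : (Φ Y X).rTensor C ∘ₗ (regularCoaction K C).coact = (ρ Y X).coact ∘ₗ Φ Y X := by
    ext c; exact (hΦ.colinear Y X c).symm
  have h₂ : twistBilin (canonicalPsi hG X Y) (compMap K X Y X) ∘ₗ (ρ Y X).coact ∘ₗ Φ Y X =
      (compMap K X Y X ∘ₗ Φ Y X).compr₂ (ρ X X).coact := by
    ext c f
    exact (twistBilin_apply _ _ _ _).trans (coact_comp hG f (Φ Y X c)).symm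
  rw [h₁, h₂]
  ext c
  rw [← RightCoaction.map_conv, hΦ.conv_right]
  simp

include hΦ in
/-- `ψ(c₁ ⊗ Φ'(c₂)) = Φ'(c)·ρ(id)`. Both sides agree after convolution with `Φ` on the left,
which is invertible. -/
lemma IsCleaving.conv_psi (X Y : D) :
    (regularCoaction K C).conv (TensorProduct.curry (canonicalPsi hG X Y)) (Φ' X Y) =
      (LinearMap.rTensorHom C ∘ₗ compMap K X X Y ∘ₗ Φ' X Y).flip ((ρ X X).coact (𝟙 X)) := by
  rw [← RightCoaction.conv_counit (regularCoaction K C), ← hΦ.conv_conv_psi hG,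
    ← (regularCoaction K C).conv_assoc (compMap K Y X Y ∘ₗ Φ' X Y)
      (LinearMap.rTensorHom C ∘ₗ compMap K X Y Y) _ (Φ Y X), hΦ.conv_left]
  · have h : (LinearMap.rTensorHom C ∘ₗ compMap K X Y Y) ∘ₗ
        (Coalgebra.counit (R := K) (A := C)).smulRight (𝟙 Y) =
        (Coalgebra.counit (R := K) (A := C)).smulRight LinearMap.id := by
      have h₁ : compMap K X Y Y (𝟙 Y) = LinearMap.id := by ext; simp
      apply LinearMap.ext
      intro c
      simp only [LinearMap.comp_apply, LinearMap.smulRight_apply, map_smul, h₁,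
        LinearMap.coe_rTensorHom, LinearMap.rTensor_id]
    rw [h, counit_conv, LinearMap.id_comp]
  · intro n c k
    have h₁ : compMap K X Y Y (compMap K Y X Y (Φ' X Y n) (Φ Y X c)) =
        compMap K X X Y (Φ' X Y n) ∘ₗ compMap K X Y X (Φ Y X c) := by ext; simp
    simp only [LinearMap.comp_apply, LinearMap.coe_rTensorHom, h₁, LinearMap.rTensor_comp_apply]

/-! ### The projection onto the coinvariants -/

variable {hG}

namespace EntwinedModule

variable (N : EntwinedModule (canonicalEntwining hG))

lemma action_comp {U V W : D} (a : U ⟶ V) (b : V ⟶ W) (n : N.toMod.obj.obj (op W)) :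
    N.toMod.action U V (N.toMod.action V W n b) a = N.toMod.action U W n (a ≫ b) := by
  simp only [RightMod.action_apply, op_comp, Functor.map_comp, ConcreteCategory.comp_apply]

lemma action_id {X : D} (n : N.toMod.obj.obj (op X)) : N.toMod.action X X n (𝟙 X) = n := by
  simp

/-- If `n` is coinvariant, then `f ↦ n·f` is colinear. -/
lemma coact_action_of_mem {W X : D} {n : N.toMod.obj.obj (op X)} (hn : n ∈ coinvSubmodule N X)
    (f : W ⟶ X) : (N.coaction W).coact (N.toMod.action W X n f) =
      (N.toMod.action W X n).rTensor C ((ρ W X).coact f) := by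
  rw [mem_coinvSubmodule] at hn
  have h₁ := twist_natural ((canonicalEntwining hG).psi W X) (compMap K W X X)
    (N.toMod.action W X) (N.toMod.action X X n) (N.toMod.action W X n)
    (fun b a => (N.action_comp a b n).symm) f ((ρ X X).coact (𝟙 X))
  have h₂ := coact_comp hG f (𝟙 X)
  rw [Category.comp_id] at h₂
  change _ = twist ((canonicalEntwining hG).psi W X) _ _ _ at h₂
  rw [RightMod.action_apply, N.compat, hn, ← h₁, ← h₂]

variable (Φ') in
/-- The map `N(X) → N(Z)`, `n ↦ n₀·Φ'(n₁)`. -/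
def proj (Z X : D) : (N.toMod.obj.obj (op X) : Type u) →ₗ[K] (N.toMod.obj.obj (op Z) : Type u) :=
  (N.coaction X).conv (N.toMod.action Z X) (Φ' Z X)

include hΦ in
/-- `n₀·Φ'(n₁)` is coinvariant: its image under the coaction is `n₀·Φ'(n₂)_ψ ⊗ n₁^ψ`, which is
`n₀·Φ'(n₁)ρ(id)` by `IsCleaving.conv_psi`. -/
lemma proj_mem (Z X : D) (n : N.toMod.obj.obj (op X)) : N.proj Φ' Z X n ∈ coinvSubmodule N Z := by
  rw [mem_coinvSubmodule, proj, RightCoaction.map_conv]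
  have h₁ : (N.toMod.action Z X).compr₂ (N.coaction Z).coact =
      twistBilin (canonicalPsi hG Z X) (N.toMod.action Z X) ∘ₗ
        (N.coaction X).conv (TensorProduct.mk K _ C ∘ₗ LinearMap.id) LinearMap.id := by
    rw [RightCoaction.conv_mk, LinearMap.rTensor_id, LinearMap.id_comp]
    ext n f
    exact (N.compat f n).trans (twistBilin_apply _ _ _ _).symm
  rw [h₁, (N.coaction X).conv_assoc _ _ (LinearMap.rTensorHom C ∘ₗ N.toMod.action Z X) _ _
    (TensorProduct.curry (canonicalPsi hG Z X)) (fun n c k => rfl), hΦ.conv_psi hG]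
  change _ = (LinearMap.rTensorHom C ∘ₗ N.toMod.action Z Z).flip ((ρ Z Z).coact (𝟙 Z))
    ((N.coaction X).conv (N.toMod.action Z X) (Φ' Z X) n)
  rw [RightCoaction.map_conv, RightCoaction.conv_apply, RightCoaction.conv_apply]
  congr 2
  ext n c
  simp only [LinearMap.compl₂_apply, LinearMap.comp_apply, LinearMap.flip_apply,
    LinearMap.compr₂_apply, LinearMap.coe_rTensorHom]
  rw [← LinearMap.rTensor_comp_apply]
  congr 2
  ext g
  exact (N.action_comp g (Φ' Z X c) n).symm

/-- The map `N(X) → N^co(Z)`, `n ↦ n₀·Φ'(n₁)`. -/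
def projCoinv (Z X : D) : (N.toMod.obj.obj (op X) : Type u) →ₗ[K] coinvSubmodule N Z :=
  (N.proj Φ' Z X).codRestrict _ (N.proj_mem hΦ Z X)

include hΦ in
/-- `n₀·Φ'(n₁)Φ(n₂) = n`. -/
lemma conv_proj (Z X : D) :
    (N.coaction X).conv (N.toMod.action X Z ∘ₗ N.proj Φ' Z X) (Φ X Z) = LinearMap.id := by
  rw [proj, (N.coaction X).conv_assoc _ _ (N.toMod.action X X) _ _ (compMap K X Z X ∘ₗ Φ' Z X)
    (fun n c k => N.action_comp k (Φ' Z X c) n), hΦ.conv_left, RightCoaction.conv_counit]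
  ext n
  exact N.action_id n

end EntwinedModule

/-! ### Projecting morphisms of `D` to morphisms of coinvariants -/

variable (hG) in
/-- The representable right `D`-module `Hom_D(-,V)`, as an entwined module. -/
def homEntwined (V : D) : EntwinedModule (canonicalEntwining hG) where
  toMod :=
    { obj := (linearYoneda K D).obj V
      property :=
        ⟨fun f g => by ext a; exact Preadditive.add_comp _ _ _ f g a,
          fun r f => by ext a; exact Linear.smul_comp _ _ _ r f a⟩ }
  coaction X := ρ X V
  compat f g := coact_comp hG f g

/-- A coinvariant element of the entwined module `Hom_D(-,V)` is a morphism of coinvariants. -/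
lemma mem_coinvHom_of_mem_coinvSubmodule {Z V : D} {g : Z ⟶ V}
    (hg : g ∈ coinvSubmodule (homEntwined hG V) Z) : g ∈ coinvHom ρ Z V :=
  fun _ f => (homEntwined hG V).coact_action_of_mem hg f

variable (ρ Φ') in
/-- The map `Hom_D(X,V) → Hom_D(Z,V)`, `g ↦ g₀Φ'(g₁)`. -/
def projHom (Z X V : D) : (X ⟶ V) →ₗ[K] (Z ⟶ V) :=
  (ρ X V).conv (compMap K Z X V) (Φ' Z X)

include hG hΦ in
lemma projHom_mem (Z X V : D) (g : X ⟶ V) : projHom ρ Φ' Z X V g ∈ coinvHom ρ Z V :=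
  mem_coinvHom_of_mem_coinvSubmodule ((homEntwined hG V).proj_mem hΦ Z X g)

include hG hΦ in
/-- `g₀Φ'(g₁)Φ(g₂) = g`. -/
lemma conv_projHom (Z X V : D) :
    (ρ X V).conv (compMap K X Z V ∘ₗ projHom ρ Φ' Z X V) (Φ X Z) = LinearMap.id :=
  (homEntwined hG V).conv_proj hΦ Z X

include hΦ in
/-- `Φ(c)₀Φ'(Φ(c)₁) = ε(c) id`, since `Φ(c)₀ ⊗ Φ(c)₁ = Φ(c₁) ⊗ c₂`. -/
lemma projHom_apply_self (Z X : D) (c : C) :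
    projHom ρ Φ' Z X Z (Φ X Z c) = Coalgebra.counit (R := K) c • 𝟙 Z := by
  rw [projHom, RightCoaction.conv_of_coact_eq _ _ _ _ (hΦ.colinear X Z c), hΦ.conv_right]
  rfl

/-- If `a` is a morphism of coinvariants, then `(ag)₀Φ'((ag)₁) = a g₀Φ'(g₁)`. -/
lemma projHom_comp (Z X : D) {V W : CoinvCat ρ} (a : V ⟶ W) (g : X ⟶ V.of) :
    projHom ρ Φ' Z X W.of (g ≫ a.1) = projHom ρ Φ' Z X V.of g ≫ a.1 := by
  refine ((ρ X W.of).conv_of_coact_eq (ρ X V.of) (compMap K Z X W.of) (Φ' Z X) (a.2 X g)).trans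
    (Eq.trans ?_ ((ρ X V.of).map_conv (compMap K Z X V.of) (Φ' Z X)
      (Linear.rightComp K Z a.1) g).symm)
  congr 2
  ext; simp

variable (hG) in
/-- The map `Hom_D(X,V) → Hom_E(Z,V)`, `g ↦ g₀Φ'(g₁)`. -/
def projE (Z : CoinvCat ρ) (X : D) (V : CoinvCat ρ) : (X ⟶ V.of) →ₗ[K] (Z ⟶ V) :=
  (projHom ρ Φ' Z.of X V.of).codRestrict (coinvHom ρ Z.of V.of)
    (projHom_mem (hG := hG) hΦ Z.of X V.of)

/-- `(n·g)₀·Φ'((n·g)₁) = n·(g₀Φ'(g₁))` for coinvariant `n`. -/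
lemma EntwinedModule.proj_action (N : EntwinedModule (canonicalEntwining hG)) (Z X V : D)
    {n : N.toMod.obj.obj (op V)} (hn : n ∈ coinvSubmodule N V) (g : X ⟶ V) :
    N.proj Φ' Z X (N.toMod.action X V n g) = N.toMod.action Z V n (projHom ρ Φ' Z X V g) := by
  rw [proj, RightCoaction.conv_of_coact_eq _ _ _ _ (N.coact_action_of_mem hn g), projHom,
    RightCoaction.map_conv]
  congr 2
  ext g k
  exact N.action_comp k g n

/-! ### The counit `N^co ⊗_E h → N` -/

namespace EntwinedModule

variable (N : EntwinedModule (canonicalEntwining hG))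

lemma counitMap_balanced (X : D) {Z W : CoinvCat ρ} (e : Z ⟶ W) (n : (coinvMod N).obj.obj (op W))
    (g : X ⟶ Z.of) :
    (N.toMod.action X Z.of ∘ₗ (coinvSubmodule N Z.of).subtype) ((coinvMod N).obj.map e.op n) g =
      (N.toMod.action X W.of ∘ₗ (coinvSubmodule N W.of).subtype) n (g ≫ e.1) :=
  N.action_comp g e.1 n.1

/-- The map `N^co ⊗_E Hom_D(X,-) → N(X)`, `n ⊗ g ↦ n·g`. -/
def counitMap (X : D) : TensorH ρ (coinvMod N).obj X →ₗ[K] (N.toMod.obj.obj (op X) : Type u) :=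
  TensorH.lift ρ (fun Z => N.toMod.action X Z.of ∘ₗ (coinvSubmodule N Z.of).subtype)
    (N.counitMap_balanced X)

lemma counitMap_mkH (X : D) (Z : CoinvCat ρ) (n : (coinvMod N).obj.obj (op Z)) (g : X ⟶ Z.of) :
    N.counitMap X (mkH ρ _ X Z n g) = N.toMod.action X Z.of n.1 g :=
  TensorH.lift_mkH ρ _ (N.counitMap_balanced X) Z n g

/-- The map `N(X) → N^co ⊗_E Hom_D(X,-)`, `n ↦ n₀·Φ'(n₁) ⊗ Φ(n₂)`, inverse to
`n ⊗ g ↦ n·g`. -/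
def counitInv (X : D) : (N.toMod.obj.obj (op X) : Type u) →ₗ[K] TensorH ρ (coinvMod N).obj X :=
  (N.coaction X).conv (mkH ρ (coinvMod N).obj X ⟨X⟩ ∘ₗ N.projCoinv hΦ X X) (Φ X X)

include hΦ in
lemma counitMap_bijective (X : D) : Function.Bijective (N.counitMap X) := by
  refine Function.bijective_iff_has_inverse.2 ⟨N.counitInv hΦ X, fun t => ?_, fun n => ?_⟩
  · suffices h : N.counitInv hΦ X ∘ₗ N.counitMap X = LinearMap.id from LinearMap.congr_fun h t
    refine TensorH.hom_ext ρ fun V n g => ?_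
    have h₁ : (mkH ρ (coinvMod N).obj X ⟨X⟩ ∘ₗ N.projCoinv hΦ X X) ∘ₗ N.toMod.action X V.of n.1 =
        (compMap K X X V.of ∘ₗ projHom ρ Φ' X X V.of).compr₂ (mkH ρ (coinvMod N).obj X V n) := by
      apply LinearMap.ext
      intro g
      apply LinearMap.ext
      intro k
      have h₂ : N.projCoinv hΦ X X (N.toMod.action X V.of n.1 g) =
          (coinvMod N).obj.map (projE hG hΦ ⟨X⟩ X V g).op n :=
        Subtype.ext (N.proj_action X X V.of n.2 g)
      exact (congrArg (fun x => mkH ρ (coinvMod N).obj X ⟨X⟩ x k) h₂).trans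
        (mkH_balanced ρ _ X _ n k)
    rw [LinearMap.comp_apply, counitMap_mkH, counitInv,
      RightCoaction.conv_of_coact_eq _ _ _ _ (N.coact_action_of_mem n.2 g), h₁,
      ← RightCoaction.map_conv, conv_projHom (hG := hG) hΦ]
    rfl
  · rw [counitInv, RightCoaction.map_conv]
    refine Eq.trans ?_ (LinearMap.congr_fun (N.conv_proj hΦ X X) n)
    congr 2
    apply LinearMap.ext
    intro n
    apply LinearMap.ext
    intro g
    exact N.counitMap_mkH X ⟨X⟩ (N.projCoinv hΦ X X n) g

end EntwinedModule

/-! ### The unit `M → (M ⊗_E h)^co` -/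

variable (M : RightMod K (CoinvCat ρ))

lemma mkH_id_mem (X : CoinvCat ρ) (m : M.obj.obj (op X)) :
    mkH ρ M.obj X.of X m (𝟙 X.of) ∈ coinvSubmodule (tensorEntwined hG M) X.of := by
  refine (mem_coinvSubmodule (tensorEntwined hG M) _).2
    ((coactH_mkH ρ M.obj X m (𝟙 X.of)).trans ?_)
  congr 2
  ext g
  refine Eq.trans ?_ (actH_mkH ρ M.obj X m (𝟙 X.of) g).symm
  rw [Category.comp_id]

variable (hG) in
/-- The map `M(X) → (M ⊗_E h)^co(X)`, `m ↦ m ⊗ id`. -/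
def unitMap (X : CoinvCat ρ) :
    (M.obj.obj (op X) : Type u) →ₗ[K] coinvSubmodule (tensorEntwined hG M) X.of :=
  ((mkH ρ M.obj X.of X).flip (𝟙 X.of)).codRestrict _ (mkH_id_mem M X)

include hΦ in
lemma retract_balanced (Z : CoinvCat ρ) (X : D) {V W : CoinvCat ρ} (e : V ⟶ W)
    (m : M.obj.obj (op W)) (g : X ⟶ V.of) :
    (M.action Z V).compl₂ (projE hG hΦ Z X V) (M.obj.map e.op m) g =
      (M.action Z W).compl₂ (projE hG hΦ Z X W) m (g ≫ e.1) := by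
  have h : projE hG hΦ Z X W (g ≫ e.1) = projE hG hΦ Z X V g ≫ e :=
    Subtype.ext (projHom_comp Z.of X e g)
  simp only [LinearMap.compl₂_apply, RightMod.action_apply, h, op_comp, Functor.map_comp,
    ConcreteCategory.comp_apply]

variable (hG) in
/-- The map `M ⊗_E Hom_D(X,-) → M(Z)`, `m ⊗ g ↦ m·(g₀Φ'(g₁))`. -/
def retract (Z : CoinvCat ρ) (X : D) :
    TensorH ρ M.obj X →ₗ[K] (M.obj.obj (op Z) : Type u) :=
  TensorH.lift ρ (fun V => (M.action Z V).compl₂ (projE hG hΦ Z X V)) (retract_balanced hΦ M Z X)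

lemma retract_mkH (Z : CoinvCat ρ) (X : D) (V : CoinvCat ρ) (m : M.obj.obj (op V))
    (g : X ⟶ V.of) :
    retract hG hΦ M Z X (mkH ρ M.obj X V m g) = M.action Z V m (projE hG hΦ Z X V g) :=
  TensorH.lift_mkH ρ _ (retract_balanced hΦ M Z X) V m g

/-- For `q(m ⊗ g) = m·(g₀Φ'(g₁))` one has `q(t) ⊗ id = t₀·Φ'(t₁)`. -/
lemma mkH_retract (Z : CoinvCat ρ) (X : D) (t : TensorH ρ M.obj X) :
    mkH ρ M.obj Z.of Z (retract hG hΦ M Z X t) (𝟙 Z.of) =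
      (tensorEntwined hG M).proj Φ' Z.of X t := by
  suffices h : (mkH ρ M.obj Z.of Z).flip (𝟙 Z.of) ∘ₗ retract hG hΦ M Z X =
      (tensorEntwined hG M).proj Φ' Z.of X from LinearMap.congr_fun h t
  refine TensorH.hom_ext ρ fun V m g => ?_
  have h₁ : (tensorEntwined hG M).proj Φ' Z.of X (mkH ρ M.obj X V m g) =
      mkH ρ M.obj Z.of V m (projHom ρ Φ' Z.of X V.of g) := by
    rw [projHom, RightCoaction.map_conv, EntwinedModule.proj]
    refine ((coactionH ρ M.obj X).conv_of_coact_eq (ρ X V.of) (actH ρ M.obj Z.of X) (Φ' Z.of X)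
      (coactH_mkH ρ M.obj V m g)).trans ?_
    congr 2
    apply LinearMap.ext
    intro g
    apply LinearMap.ext
    intro k
    exact actH_mkH ρ M.obj V m g k
  refine Eq.trans ?_ h₁.symm
  rw [LinearMap.comp_apply, retract_mkH, LinearMap.flip_apply, RightMod.action_apply,
    mkH_balanced, Category.id_comp]
  rfl

include hΦ in
lemma unitMap_bijective (X : CoinvCat ρ) : Function.Bijective (unitMap hG M X) := by
  -- A zero counit forces `C = 0`, and then both sides vanish.
  by_cases hε : (Coalgebra.counit (R := K) (A := C)) = 0
  · have h₁ : 𝟙 X = 0 := Subtype.ext ((ρ X.of X.of).eq_zero_of_counit hε _)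
    have h₂ : ∀ m : M.obj.obj (op X), m = 0 := fun m => by
      have h₃ : M.action X X m (𝟙 X) = m := by simp
      rw [← h₃, h₁, map_zero]
    refine ⟨fun m m' _ => (h₂ m).trans (h₂ m').symm, fun t => ⟨0, ?_⟩⟩
    rw [map_zero]
    exact (Subtype.ext (((tensorEntwined hG M).coaction X.of).eq_zero_of_counit hε _)).symm
  obtain ⟨c, hc⟩ : ∃ c, Coalgebra.counit (R := K) (A := C) c = 1 := by
    obtain ⟨c, hc⟩ := DFunLike.ne_iff.1 hε
    refine ⟨(Coalgebra.counit (R := K) c)⁻¹ • c, ?_⟩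
    rw [map_smul, smul_eq_mul, inv_mul_cancel₀ hc]
  have hΦc : projHom ρ Φ' X.of X.of X.of (Φ X.of X.of c) = 𝟙 X.of := by
    rw [projHom_apply_self hΦ, hc, one_smul]
  refine Function.bijective_iff_has_inverse.2
    ⟨fun t => retract hG hΦ M X X.of (actH ρ M.obj X.of X.of t.1 (Φ X.of X.of c)), fun m => ?_,
      fun t => Subtype.ext ?_⟩
  · change retract hG hΦ M X X.of (actH ρ M.obj X.of X.of (mkH ρ M.obj X.of X m (𝟙 X.of)) _) = m
    have h : projE hG hΦ X X.of X (Φ X.of X.of c) = 𝟙 X := Subtype.ext hΦc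
    rw [actH_mkH, Category.comp_id, retract_mkH, h]
    simp
  · refine (mkH_retract hΦ M X X.of _).trans
      (((tensorEntwined hG M).proj_action X.of X.of X.of t.2 (Φ X.of X.of c)).trans ?_)
    rw [hΦc]
    exact (tensorEntwined hG M).action_id t.1

end Cleft

section Equivalence

variable {K : Type w₁} [Field K] {C : Type w₂} [AddCommGroup C] [Module K C] [Coalgebra K C]
variable {D : Type u} [Category.{u} D] [Preadditive D] [Linear K D]

/-! ### Isomorphisms of modules and of entwined modules -/

lemma RightMod.isIso_of_bijective {M N : RightMod K D} (α : M ⟶ N)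
    (h : ∀ X : D, Function.Bijective (α.hom.app (op X)).hom) : IsIso α := by
  have h₁ : ∀ X : Dᵒᵖ, IsIso (α.hom.app X) := fun X =>
    (ConcreteCategory.isIso_iff_bijective _).2 (h X.unop)
  have h₂ : IsIso α.hom := NatIso.isIso_of_isIso_app _
  have h₃ : IsIso ((isLinearModule K D).ι.map α) := h₂
  exact isIso_of_fully_faithful (isLinearModule K D).ι α

lemma EntwinedModule.isIso_of_bijective {S : EntwiningStructure K C D} {M N : EntwinedModule S}
    (α : M ⟶ N) (h : ∀ X : D, Function.Bijective (α.hom.hom.app (op X)).hom) : IsIso α := by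
  have h₁ : IsIso α.hom := RightMod.isIso_of_bijective α.hom h
  have h₂ : ∀ X : D, (inv α.hom).hom.app (op X) ≫ α.hom.hom.app (op X) = 𝟙 _ := fun X =>
    congrArg (fun β : N.toMod ⟶ N.toMod => β.hom.app (op X)) (IsIso.inv_hom_id α.hom)
  have h₃ : ∀ X : D, α.hom.hom.app (op X) ≫ (inv α.hom).hom.app (op X) = 𝟙 _ := fun X =>
    congrArg (fun β : M.toMod ⟶ M.toMod => β.hom.app (op X)) (IsIso.hom_inv_id α.hom)
  refine ⟨⟨inv α.hom, fun X n => ?_⟩, EntwinedModule.Hom.ext (IsIso.hom_inv_id α.hom),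
    EntwinedModule.Hom.ext (IsIso.inv_hom_id α.hom)⟩
  have h₄ := α.colinear X ((inv α.hom).hom.app (op X) n)
  have h₅ : (α.hom.hom.app (op X)).hom ((inv α.hom).hom.app (op X) n) = n :=
    ConcreteCategory.congr_hom (h₂ X) n
  have h₆ : ((inv α.hom).hom.app (op X)).hom ∘ₗ (α.hom.hom.app (op X)).hom = LinearMap.id :=
    congrArg ModuleCat.Hom.hom (h₃ X)
  rw [h₅] at h₄
  rw [h₄, ← LinearMap.rTensor_comp_apply, h₆, LinearMap.rTensor_id_apply]

/-! ### The unit and the counit as natural isomorphisms -/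

variable {ρ : ∀ X Y : D, RightCoaction K C (X ⟶ Y)} (hG : IsGaloisExtension ρ)

/-- The natural transformation `M → (M ⊗_E h)^co`, `m ↦ m ⊗ id`. -/
def unitNatTrans : 𝟭 (RightMod K (CoinvCat ρ)) ⟶ tensorFunctor hG ⋙ coinvFunctor hG where
  app M := ObjectProperty.homMk
    { app := fun X => ModuleCat.ofHom (unitMap hG M X.unop)
      naturality := fun Y X f => by
        ext m
        apply Subtype.ext
        change mkH ρ M.obj X.unop.of X.unop (M.obj.map f m) (𝟙 X.unop.of) =
          actH ρ M.obj X.unop.of Y.unop.of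
            (mkH ρ M.obj Y.unop.of Y.unop m (𝟙 Y.unop.of)) f.unop.1
        rw [actH_mkH, Category.comp_id]
        refine (mkH_balanced ρ M.obj X.unop.of f.unop m (𝟙 X.unop.of)).trans ?_
        rw [Category.id_comp] }
  naturality M N α := by
    ext X m
    apply Subtype.ext
    exact (mapH_mkH ρ α.hom X.unop m (𝟙 X.unop.of)).symm

namespace EntwinedModule

variable {hG}

lemma counitMap_actH (N : EntwinedModule (canonicalEntwining hG)) {X Y : D} (f : X ⟶ Y)
    (t : TensorH ρ (coinvMod N).obj Y) :
    N.counitMap X (actH ρ _ X Y t f) = N.toMod.action X Y (N.counitMap Y t) f := by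
  suffices h : N.counitMap X ∘ₗ (actH ρ (coinvMod N).obj X Y).flip f =
      (N.toMod.action X Y).flip f ∘ₗ N.counitMap Y from LinearMap.congr_fun h t
  refine TensorH.hom_ext ρ fun Z n g => ?_
  rw [LinearMap.comp_apply, LinearMap.comp_apply, LinearMap.flip_apply, LinearMap.flip_apply,
    actH_mkH, N.counitMap_mkH, N.counitMap_mkH, N.action_comp]

lemma coact_counitMap (N : EntwinedModule (canonicalEntwining hG)) (X : D)
    (t : TensorH ρ (coinvMod N).obj X) :
    (N.coaction X).coact (N.counitMap X t) = (N.counitMap X).rTensor C (coactH ρ _ X t) := by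
  suffices h : (N.coaction X).coact ∘ₗ N.counitMap X =
      (N.counitMap X).rTensor C ∘ₗ coactH ρ (coinvMod N).obj X from LinearMap.congr_fun h t
  refine TensorH.hom_ext ρ fun Z n g => ?_
  rw [LinearMap.comp_apply, LinearMap.comp_apply, N.counitMap_mkH, coactH_mkH,
    ← LinearMap.rTensor_comp_apply, N.coact_action_of_mem n.2]
  congr 2
  ext g
  exact (N.counitMap_mkH X Z n g).symm

lemma counitMap_mapH {M N : EntwinedModule (canonicalEntwining hG)} (α : M ⟶ N) (X : D)
    (t : TensorH ρ (coinvMod M).obj X) :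
    N.counitMap X (mapH ρ ((coinvFunctor hG).map α).hom X t) =
      α.hom.hom.app (op X) (M.counitMap X t) := by
  suffices h : N.counitMap X ∘ₗ mapH ρ ((coinvFunctor hG).map α).hom X =
      (α.hom.hom.app (op X)).hom ∘ₗ M.counitMap X from LinearMap.congr_fun h t
  refine TensorH.hom_ext ρ fun Z n g => ?_
  refine (congrArg (N.counitMap X) (mapH_mkH ρ ((coinvFunctor hG).map α).hom Z n g)).trans ?_
  refine (N.counitMap_mkH X Z _ g).trans ?_
  refine (ConcreteCategory.congr_hom (α.hom.hom.naturality g.op) n.1).symm.trans ?_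
  exact congrArg (α.hom.hom.app (op X)) (M.counitMap_mkH X Z n g).symm

end EntwinedModule

/-- The natural transformation `N^co ⊗_E h → N`, `n ⊗ g ↦ n·g`. -/
def counitNatTrans :
    coinvFunctor hG ⋙ tensorFunctor hG ⟶ 𝟭 (EntwinedModule (canonicalEntwining hG)) where
  app N :=
    { hom := ObjectProperty.homMk
        { app := fun X => ModuleCat.ofHom (N.counitMap X.unop)
          naturality := fun Y X f => by
            ext1
            exact LinearMap.ext fun t => N.counitMap_actH f.unop t }
      colinear := fun X t => N.coact_counitMap X t }
  naturality M N α := by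
    apply EntwinedModule.Hom.ext
    ext X : 4
    exact LinearMap.ext fun t => EntwinedModule.counitMap_mapH α X.unop t

variable {hG} {Φ Φ' : ∀ X Y : D, C →ₗ[K] (X ⟶ Y)} (hΦ : IsCleaving ρ Φ Φ')

include hΦ in
lemma IsCleaving.isIso_unitNatTrans : IsIso (unitNatTrans hG) := by
  have (M : RightMod K (CoinvCat ρ)) : IsIso ((unitNatTrans hG).app M) :=
    RightMod.isIso_of_bijective _ (unitMap_bijective hΦ M)
  exact NatIso.isIso_of_isIso_app _

include hΦ in
lemma IsCleaving.isIso_counitNatTrans : IsIso (counitNatTrans hG) := by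
  have (N : EntwinedModule (canonicalEntwining hG)) : IsIso ((counitNatTrans hG).app N) :=
    EntwinedModule.isIso_of_bijective _ (N.counitMap_bijective hΦ)
  exact NatIso.isIso_of_isIso_app _

end Equivalence

end

end CatGalois

theorem theorem4p22 {K : Type w₁} [Field K]
    {C : Type w₂} [AddCommGroup C] [Module K C] [Coalgebra K C]
    {D : Type u} [Category.{u} D] [Preadditive D] [Linear K D]
    (ρ : ∀ X Y : D, CatGalois.RightCoaction K C (X ⟶ Y))
    (hG : CatGalois.IsGaloisExtension ρ)
    (Φ : ∀ X Y : D, C →ₗ[K] (X ⟶ Y))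
    (hcolin : ∀ X Y : D, CatGalois.IsColinear (CatGalois.regularCoaction K C) (ρ X Y) (Φ X Y))
    (hconv : CatGalois.IsConvolutionInvertible Φ) :
    ∃ e : CatGalois.RightMod K (CatGalois.CoinvCat ρ) ≌
        CatGalois.EntwinedModule (CatGalois.canonicalEntwining hG),
      e.functor = CatGalois.tensorFunctor hG ∧ e.inverse = CatGalois.coinvFunctor hG := by
  obtain ⟨Φ', hΦ'⟩ := hconv
  have hΦ : CatGalois.IsCleaving ρ Φ Φ' :=
    { colinear := hcolin
      conv_right := fun X Y => by
        rw [← CatGalois.convolution_eq_conv]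
        exact LinearMap.ext fun c => (hΦ' X Y c).1
      conv_left := fun X Y => by
        rw [← CatGalois.convolution_eq_conv]
        exact LinearMap.ext fun c => (hΦ' X Y c).2 }
  have := hΦ.isIso_unitNatTrans (hG := hG)
  have := hΦ.isIso_counitNatTrans (hG := hG)
  exact ⟨CategoryTheory.Equivalence.mk _ _ (asIso (CatGalois.unitNatTrans hG))
    (asIso (CatGalois.counitNatTrans hG)), rfl, rfl⟩
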